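/- Let $M$ be a smooth 8-manifold. Write $e^{ab}=e^a\wedge e^b$ for a basis $e^0,\dots,e^7$ of covectors, and let $$g_0=(e^0)^2-(e^1)^2-(e^2)^2-(e^3)^2-(e^4)^2+(e^5)^2+(e^6)^2+(e^7)^2 .$$ An $\mathrm{SL}(4,\mathbb R)$ structure on $M$ consists of smooth tensor fields $(g,K,\omega_r,\Omega_+,\Omega_-)$: a metric $g$ of signature $(4,4)$, an endomorphism field $K$ with $K^2=1$ and $g(K\cdot,K\cdot)=-g$, the real 2-form $\omega_r=g(K\cdot,\cdot)$, and two real 4-forms $\Omega_\pm$, such that every tangent space has a basis $e_0,\dots,e_7$ whose dual basis $e^0,\dots,e^7$ satisfies $g=g_0$, $K$ exchanges $e_i$ and $e_{i+4}$ for $i=0,\dots,3$, and $$\omega_r=e^{15}+e^{26}+e^{37}+e^{40},\qquad \Omega_\pm=(e^4\pm e^0)\wedge(e^1\pm e^5)\wedge(e^2\pm e^6)\wedge(e^3\pm e^7).$$ An $\mathrm{SU}(2,2)$ structure consists of smooth tensor fields $(g,J,\omega,\Omega)$: a metric $g$ of signature $(4,4)$, an orthogonal almost complex structure $J$, the real 2-form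 $\omega=g(J\cdot,\cdot)$, and a complex 4-form $\Omega$ of type $(4,0)$, such that every tangent space has a basis with $g=g_0$ and $$\omega=e^{12}+e^{34}+e^{56}+e^{70},\qquad \Omega=(e^7+ie^0)\wedge(e^1-ie^2)\wedge(e^3-ie^4)\wedge(e^5+ie^6).$$ Such a structure is called integrable if there is a torsion-free affine connection for which all of its tensor fields are parallel (this connection is then the Levi-Civita connection of $g$). 1. For every $\mathrm{SL}(4,\mathbb R)$ structure on $M$, with Lorentzian Cayley form $$\Phi_L=\tfrac{i}{2}(\Omega_+-\Omega_-)+\tfrac12\,\omega_r\wedge\omega_r ,$$ the structure is integrable if and only if $d\Phi_L=0$. Moreover $d\Phi_L=0$ if and only if $d\omega_r=0$, $d\Omega_+=0$ and $d\Omega_-=0$. 2. For every $\mathrm{SL}(4,\mathbb R)$ structure on $M$ and every $\theta\in(0,\pi/2)$, the structure is integrable if and only if the complex Cayley form $$\Phi_\theta=\tfrac12\cos(2\theta)(\Omega_++\Omega_-)+\tfrac{i}{2}\sin(2\theta)(\Omega_+-\Omega_-)+\tfrac12\,\omega_r\wedge\omega_r$$ is closed. 3. For every $\mathrm{SU}(2,2)$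 structure on $M$ and every real $\tau\neq 0$, the structure is integrable if and only if the complex Cayley form $$\Phi_\tau=\cosh(2\tau)\,\mathrm{Re}\,\Omega+i\sinh(2\tau)\,\mathrm{Im}\,\Omega-\tfrac12\,\omega\wedge\omega$$ is closed. -/

import Mathlib

open scoped Manifold ContDiff

namespace SplitCayley

noncomputable section

/-! ## Linear algebra of forms -/

section Algebra

variable {V : Type*} [AddCommGroup V] [Module ℝ V] [TopologicalSpace V]

/-- The wedge product of two real 2-forms, as the sum over the six `(2,2)`-shuffles
(so that `(e¹ ∧ e²) ∧ (e³ ∧ e⁴) = e¹ ∧ e² ∧ e³ ∧ e⁴` takes the value `1` on the dual vectors). -/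
def wedge₂₂ (α β : V [⋀^Fin 2]→L[ℝ] ℝ) : V [⋀^Fin 4]→L[ℝ] ℝ where
  toFun v :=
    α ![v 0, v 1] * β ![v 2, v 3] - α ![v 0, v 2] * β ![v 1, v 3]
      + α ![v 0, v 3] * β ![v 1, v 2] + α ![v 1, v 2] * β ![v 0, v 3]
      - α ![v 1, v 3] * β ![v 0, v 2] + α ![v 2, v 3] * β ![v 0, v 1]
  map_update_add' := by
    have h0 : ∀ (γ : V [⋀^Fin 2]→L[ℝ] ℝ) (x x' y : V),
        γ ![x + x', y] = γ ![x, y] + γ ![x', y] := fun γ x x' y => by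
      simpa using γ.vecCons_add ![y] x x'
    have h1 : ∀ (γ : V [⋀^Fin 2]→L[ℝ] ℝ) (x y y' : V),
        γ ![x, y + y'] = γ ![x, y] + γ ![x, y'] := fun γ x y y' => by
      have e : ∀ z : V, Function.update ![x, y] (1 : Fin 2) z = ![x, z] := fun z => by
        ext i; fin_cases i <;> simp
      simpa only [e] using γ.map_update_add ![x, y] 1 y y'
    intro inst v i x y
    obtain rfl : inst = instDecidableEqFin 4 := Subsingleton.elim _ _
    fin_cases i <;> simp [h0, h1] <;> ring
  map_update_smul' := by
    have h0 : ∀ (γ : V [⋀^Fin 2]→L[ℝ] ℝ) (c : ℝ) (x y : V),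
        γ ![c • x, y] = c * γ ![x, y] := fun γ c x y => by
      simpa using γ.vecCons_smul ![y] c x
    have h1 : ∀ (γ : V [⋀^Fin 2]→L[ℝ] ℝ) (c : ℝ) (x y : V),
        γ ![x, c • y] = c * γ ![x, y] := fun γ c x y => by
      have e : ∀ z : V, Function.update ![x, y] (1 : Fin 2) z = ![x, z] := fun z => by
        ext i; fin_cases i <;> simp
      simpa only [e, smul_eq_mul] using γ.map_update_smul ![x, y] 1 c y
    intro inst v i c x
    obtain rfl : inst = instDecidableEqFin 4 := Subsingleton.elim _ _
    fin_cases i <;> simp [h0, h1] <;> ring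
  map_eq_zero_of_eq' := by
    have hz : ∀ (γ : V [⋀^Fin 2]→L[ℝ] ℝ) (x : V), γ ![x, x] = 0 := fun γ x =>
      γ.map_eq_zero_of_eq ![x, x] (i := 0) (j := 1) rfl (by decide)
    have hs : ∀ (γ : V [⋀^Fin 2]→L[ℝ] ℝ) (x y : V), γ ![x, y] = -γ ![y, x] := fun γ x y => by
      have e : ![y, x] ∘ Equiv.swap (0 : Fin 2) 1 = ![x, y] := by
        ext i; fin_cases i <;> simp
      have h : γ (![y, x] ∘ Equiv.swap (0 : Fin 2) 1) = -γ ![y, x] :=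
        γ.toAlternatingMap.map_swap ![y, x] (i := 0) (j := 1) (by decide)
      rwa [e] at h
    intro v i j hv hij
    fin_cases i <;> fin_cases j <;> simp at hv hij ⊢ <;>
      simp only [hv, hz, hs α (v 1) (v 0), hs α (v 2) (v 0), hs α (v 2) (v 1),
        hs α (v 3) (v 1), hs α (v 3) (v 2), hs β (v 1) (v 0), hs β (v 2) (v 0),
        hs β (v 2) (v 1), hs β (v 3) (v 1), hs β (v 3) (v 2)] <;> ring
  cont := by
    have hc : ∀ (γ : V [⋀^Fin 2]→L[ℝ] ℝ) (a b : Fin 4),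
        Continuous fun v : Fin 4 → V => γ ![v a, v b] := fun γ a b => by
      refine γ.cont.comp (continuous_pi fun i => ?_)
      fin_cases i <;> simp <;> fun_prop
    exact ((((((hc α 0 1).mul (hc β 2 3)).sub ((hc α 0 2).mul (hc β 1 3))).add
      ((hc α 0 3).mul (hc β 1 2))).add ((hc α 1 2).mul (hc β 0 3))).sub
      ((hc α 1 3).mul (hc β 0 2))).add ((hc α 2 3).mul (hc β 0 1))

/-- A real form regarded as a complex-valued form. -/
def complexify {k : ℕ} (η : V [⋀^Fin k]→L[ℝ] ℝ) : V [⋀^Fin k]→L[ℝ] ℂ :=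
  Complex.ofRealCLM.compContinuousAlternatingMap η

/-- The real part of a complex-valued form. -/
def rePart {k : ℕ} (η : V [⋀^Fin k]→L[ℝ] ℂ) : V [⋀^Fin k]→L[ℝ] ℝ :=
  Complex.reCLM.compContinuousAlternatingMap η

/-- The imaginary part of a complex-valued form. -/
def imPart {k : ℕ} (η : V [⋀^Fin k]→L[ℝ] ℂ) : V [⋀^Fin k]→L[ℝ] ℝ :=
  Complex.imCLM.compContinuousAlternatingMap η

/-- The value `(α₁ ∧ ... ∧ αₖ)(v₁, ..., vₖ) = det (αᵢ(vⱼ))` of a wedge product of real or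
complex covectors. -/
def wedgeCovectors {W 𝕜 : Type*} [CommRing 𝕜] {k : ℕ} (α : Fin k → W → 𝕜) (v : Fin k → W) : 𝕜 :=
  Matrix.det (Matrix.of fun i j => α i (v j))

end Algebra

/-! ## The two model structures on a real vector space with basis `e₀, ..., e₇`

In both models the metric is the split octonion pairing, which is positive on `e₀, e₅, e₆, e₇`
and negative on `e₁, e₂, e₃, e₄`. Write `eⁱ` for the dual basis. -/

section Models

variable {V : Type*} [AddCommGroup V] [Module ℝ V] (e : Module.Basis (Fin 8) ℝ V)

/-- The metric `(e⁰)² - (e¹)² - (e²)² - (e³)² - (e⁴)² + (e⁵)² + (e⁶)² + (e⁷)²`. -/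
def modelMetric (v w : V) : ℝ :=
  e.coord 0 v * e.coord 0 w - e.coord 1 v * e.coord 1 w - e.coord 2 v * e.coord 2 w
    - e.coord 3 v * e.coord 3 w - e.coord 4 v * e.coord 4 w + e.coord 5 v * e.coord 5 w
    + e.coord 6 v * e.coord 6 w + e.coord 7 v * e.coord 7 w

/-- The 2-form `e^{ab} = eᵃ ∧ eᵇ`. -/
def modelTwo (a b : Fin 8) (v : Fin 2 → V) : ℝ :=
  wedgeCovectors ![e.coord a, e.coord b] v

/-- `Ω₊ = (e⁴ + e⁰) ∧ (e¹ + e⁵) ∧ (e² + e⁶) ∧ (e³ + e⁷)`. -/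
def modelOmegaPlus (v : Fin 4 → V) : ℝ :=
  wedgeCovectors ![e.coord 4 + e.coord 0, e.coord 1 + e.coord 5, e.coord 2 + e.coord 6,
    e.coord 3 + e.coord 7] v

/-- `Ω₋ = (e⁴ - e⁰) ∧ (e¹ - e⁵) ∧ (e² - e⁶) ∧ (e³ - e⁷)`. -/
def modelOmegaMinus (v : Fin 4 → V) : ℝ :=
  wedgeCovectors ![e.coord 4 - e.coord 0, e.coord 1 - e.coord 5, e.coord 2 - e.coord 6,
    e.coord 3 - e.coord 7] v

/-- `ω_r = e^{15} + e^{26} + e^{37} + e^{40}`. -/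
def modelOmegaR (v : Fin 2 → V) : ℝ :=
  modelTwo e 1 5 v + modelTwo e 2 6 v + modelTwo e 3 7 v + modelTwo e 4 0 v

/-- The complex covector `eᵃ + i s eᵇ` for a real number `s`. -/
def modelCovector (a b : Fin 8) (s : ℝ) (v : V) : ℂ :=
  (e.coord a v : ℂ) + Complex.I * (s : ℂ) * (e.coord b v : ℂ)

/-- `Ω = (e⁷ + i e⁰) ∧ (e¹ - i e²) ∧ (e³ - i e⁴) ∧ (e⁵ + i e⁶)`. -/
def modelOmegaC (v : Fin 4 → V) : ℂ :=
  wedgeCovectors ![modelCovector e 7 0 1, modelCovector e 1 2 (-1), modelCovector e 3 4 (-1),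
    modelCovector e 5 6 1] v

/-- `ω = e^{12} + e^{34} + e^{56} + e^{70}`. -/
def modelOmega (v : Fin 2 → V) : ℝ :=
  modelTwo e 1 2 v + modelTwo e 3 4 v + modelTwo e 5 6 v + modelTwo e 7 0 v

end Models

/-! ## Tensor fields on 8-manifolds -/

section Manifold

variable (M : Type*) [TopologicalSpace M] [ChartedSpace (EuclideanSpace ℝ (Fin 8)) M]

/-- Differential `k`-forms on `M` with values in `F` (with no smoothness imposed). -/
abbrev Form (k : ℕ) (F : Type*) [NormedAddCommGroup F] [NormedSpace ℝ F] : Type _ :=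
  ∀ x : M, TangentSpace (𝓡 8) x [⋀^Fin k]→L[ℝ] F

/-- Bilinear forms on the tangent spaces. -/
abbrev BilinField : Type _ :=
  ∀ x : M, TangentSpace (𝓡 8) x →L[ℝ] TangentSpace (𝓡 8) x →L[ℝ] ℝ

/-- Endomorphisms of the tangent spaces. -/
abbrev EndoField : Type _ :=
  ∀ x : M, TangentSpace (𝓡 8) x →L[ℝ] TangentSpace (𝓡 8) x

variable {M}

section Forms

variable {k : ℕ} {F : Type*} [NormedAddCommGroup F] [NormedSpace ℝ F]

/-- The expression of a form in the preferred chart at `x₀`: the pullback of the form by the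
inverse of the chart. It is meaningful on the target of the chart, which is open. -/
def Form.inChart (η : Form M k F) (x₀ : M) :
    EuclideanSpace ℝ (Fin 8) → EuclideanSpace ℝ (Fin 8) [⋀^Fin k]→L[ℝ] F := fun y =>
  (η ((extChartAt (𝓡 8) x₀).symm y)).compContinuousLinearMap
    (mfderiv 𝓘(ℝ, EuclideanSpace ℝ (Fin 8)) (𝓡 8) (extChartAt (𝓡 8) x₀).symm y)

/-- A form is smooth if its expressions in the charts are. -/
def Form.IsSmooth (η : Form M k F) : Prop :=
  ∀ x₀ : M, ContDiffOn ℝ ∞ (η.inChart x₀) (extChartAt (𝓡 8) x₀).target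

/-- The exterior derivative: at `x`, pull back by the preferred chart at `x` the exterior
derivative of the expression of the form in that chart. -/
def Form.d (η : Form M k F) : Form M (k + 1) F := fun x =>
  (extDeriv (η.inChart x) (extChartAt (𝓡 8) x x)).compContinuousLinearMap
    (mfderiv (𝓡 8) 𝓘(ℝ, EuclideanSpace ℝ (Fin 8)) (extChartAt (𝓡 8) x) x)

end Forms

variable [IsManifold (𝓡 8) ∞ M]

/-- Smoothness of a field of bilinear forms. -/
def BilinField.IsSmooth (g : BilinField M) : Prop :=
  ContMDiff (𝓡 8) ((𝓡 8).prod
      𝓘(ℝ, EuclideanSpace ℝ (Fin 8) →L[ℝ] EuclideanSpace ℝ (Fin 8) →L[ℝ] ℝ)) ∞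
    (fun x => Bundle.TotalSpace.mk'
      (EuclideanSpace ℝ (Fin 8) →L[ℝ] EuclideanSpace ℝ (Fin 8) →L[ℝ] ℝ)
      (E := fun x : M => TangentSpace (𝓡 8) x →L[ℝ] TangentSpace (𝓡 8) x →L[ℝ] ℝ) x (g x))

/-- Smoothness of a field of endomorphisms. -/
def EndoField.IsSmooth (K : EndoField M) : Prop :=
  ContMDiff (𝓡 8) ((𝓡 8).prod 𝓘(ℝ, EuclideanSpace ℝ (Fin 8) →L[ℝ] EuclideanSpace ℝ (Fin 8))) ∞
    (fun x => Bundle.TotalSpace.mk' (EuclideanSpace ℝ (Fin 8) →L[ℝ] EuclideanSpace ℝ (Fin 8))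
      (E := fun x : M => TangentSpace (𝓡 8) x →L[ℝ] TangentSpace (𝓡 8) x) x (K x))

/-! ### Parallel tensor fields

`∇ Y x v` is the covariant derivative at `x` of the vector field `Y` in the direction `v`. -/

/-- Affine connections on `M`. -/
abbrev AffineConnection (M : Type*) [TopologicalSpace M]
    [ChartedSpace (EuclideanSpace ℝ (Fin 8)) M] [IsManifold (𝓡 8) ∞ M] : Type _ :=
  CovariantDerivative (𝓡 8) (EuclideanSpace ℝ (Fin 8)) (TangentSpace (𝓡 8) : M → Type _)

/-- Differentiability of a vector field at a point. -/
abbrev DiffAt (Y : ∀ y : M, TangentSpace (𝓡 8) y) (x : M) : Prop :=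
  MDifferentiableAt (𝓡 8) (𝓡 8).tangent (fun y => (⟨y, Y y⟩ : TangentBundle (𝓡 8) M)) x

/-- `∇ η = 0`, that is `v (η(Y₁, ..., Yₖ)) = ∑ᵢ η(Y₁, ..., ∇_v Yᵢ, ..., Yₖ)`. -/
def Form.IsParallel {k : ℕ} {F : Type*} [NormedAddCommGroup F] [NormedSpace ℝ F]
    (η : Form M k F) (cov : AffineConnection M) : Prop :=
  ∀ (x : M) (Y : Fin k → ∀ y : M, TangentSpace (𝓡 8) y), (∀ i, DiffAt (Y i) x) →
    ∀ v : TangentSpace (𝓡 8) x,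
      mvfderiv (𝓡 8) (fun y => η y (fun i => Y i y)) x v
        = ∑ i, η x (Function.update (fun j => Y j x) i (cov (Y i) x v))

/-- `∇ g = 0`, that is `v (g(Y, Z)) = g(∇_v Y, Z) + g(Y, ∇_v Z)`. -/
def BilinField.IsParallel (g : BilinField M) (cov : AffineConnection M) : Prop :=
  ∀ (x : M) (Y Z : ∀ y : M, TangentSpace (𝓡 8) y), DiffAt Y x → DiffAt Z x →
    ∀ v : TangentSpace (𝓡 8) x,
      mvfderiv (𝓡 8) (fun y => g y (Y y) (Z y)) x v
        = g x (cov Y x v) (Z x) + g x (Y x) (cov Z x v)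

/-- `∇ K = 0`, that is `∇_v (K Y) = K (∇_v Y)`. -/
def EndoField.IsParallel (K : EndoField M) (cov : AffineConnection M) : Prop :=
  ∀ (x : M) (Y : ∀ y : M, TangentSpace (𝓡 8) y), DiffAt Y x →
    ∀ v : TangentSpace (𝓡 8) x, cov (fun y => K y (Y y)) x v = K x (cov Y x v)

/-! ## `SL(4,ℝ)` structures and `SU(2,2)` structures -/

/-- An `SL(4,ℝ)` structure on an 8-manifold, given by its defining tensor fields: a split
signature metric `g`, an orthogonal paracomplex structure `K`, the 2-form `ω_r = g(K·,·)` and the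
two real decomposable 4-forms `Ω₊`, `Ω₋`. The tangent space at each point has a basis in which
they take their standard form; such bases form a reduction of the frame bundle to the common
stabiliser `SL(4,ℝ)` of the five standard tensors. In such a basis `K` exchanges `eᵢ` and `eᵢ₊₄`. -/
structure SL4Structure (M : Type*) [TopologicalSpace M]
    [ChartedSpace (EuclideanSpace ℝ (Fin 8)) M] [IsManifold (𝓡 8) ∞ M] where
  /-- the split signature metric -/
  g : BilinField M
  /-- the paracomplex structure -/
  K : EndoField M
  /-- the 2-form `ω_r` -/
  omegaR : Form M 2 ℝ
  /-- the 4-form `Ω₊` -/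
  OmegaPlus : Form M 4 ℝ
  /-- the 4-form `Ω₋` -/
  OmegaMinus : Form M 4 ℝ
  g_smooth : g.IsSmooth
  K_smooth : K.IsSmooth
  omegaR_smooth : omegaR.IsSmooth
  OmegaPlus_smooth : OmegaPlus.IsSmooth
  OmegaMinus_smooth : OmegaMinus.IsSmooth
  exists_adapted_basis : ∀ x : M, ∃ e : Module.Basis (Fin 8) ℝ (TangentSpace (𝓡 8) x),
    (∀ v w, g x v w = modelMetric e v w) ∧ (∀ i, K x (e i) = e (i + 4)) ∧
    (∀ v, omegaR x v = modelOmegaR e v) ∧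
    (∀ v, OmegaPlus x v = modelOmegaPlus e v) ∧ (∀ v, OmegaMinus x v = modelOmegaMinus e v)

namespace SL4Structure

variable (S : SL4Structure M)

/-- The `SL(4,ℝ)` structure is integrable (torsion-free): some torsion-free connection preserves
it. Such a connection is the Levi-Civita connection of `g`; in particular it is unique, and
automatically smooth. -/
def IsIntegrable : Prop :=
  ∃ cov : AffineConnection M, cov.torsion = 0 ∧ S.g.IsParallel cov ∧ S.K.IsParallel cov ∧
    S.omegaR.IsParallel cov ∧ S.OmegaPlus.IsParallel cov ∧ S.OmegaMinus.IsParallel cov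

/-- The Lorentzian Cayley form `Φ_L = (i/2)(Ω₊ - Ω₋) + ½ ω_r ∧ ω_r`. -/
def lorentzianCayleyForm : Form M 4 ℂ := fun x =>
  (Complex.I / 2) • (complexify (S.OmegaPlus x) - complexify (S.OmegaMinus x))
    + (1 / 2 : ℂ) • complexify (wedge₂₂ (S.omegaR x) (S.omegaR x))

/-- The complex Cayley form
`Φ_θ = cos(2θ) ½ (Ω₊ + Ω₋) + i sin(2θ) ½ (Ω₊ - Ω₋) + ½ ω_r ∧ ω_r`. -/
def complexCayleyForm (θ : ℝ) : Form M 4 ℂ := fun x =>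
  ((Real.cos (2 * θ) / 2 : ℝ) : ℂ) • (complexify (S.OmegaPlus x) + complexify (S.OmegaMinus x))
    + (Complex.I * ((Real.sin (2 * θ) / 2 : ℝ) : ℂ)) •
        (complexify (S.OmegaPlus x) - complexify (S.OmegaMinus x))
    + (1 / 2 : ℂ) • complexify (wedge₂₂ (S.omegaR x) (S.omegaR x))

end SL4Structure

/-- An `SU(2,2)` structure on an 8-manifold, given by its defining tensor fields: a split
signature metric `g`, an orthogonal complex structure `J`, the 2-form `ω = g(J·,·)` and the complex
4-form `Ω` of type `(4,0)`. The tangent space at each point has a basis in which they take their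
standard form. -/
structure SU22Structure (M : Type*) [TopologicalSpace M]
    [ChartedSpace (EuclideanSpace ℝ (Fin 8)) M] [IsManifold (𝓡 8) ∞ M] where
  /-- the split signature metric -/
  g : BilinField M
  /-- the almost complex structure -/
  J : EndoField M
  /-- the 2-form `ω` -/
  omega : Form M 2 ℝ
  /-- the complex 4-form `Ω` -/
  Omega : Form M 4 ℂ
  g_smooth : g.IsSmooth
  J_smooth : J.IsSmooth
  omega_smooth : omega.IsSmooth
  Omega_smooth : Omega.IsSmooth
  exists_adapted_basis : ∀ x : M, ∃ e : Module.Basis (Fin 8) ℝ (TangentSpace (𝓡 8) x),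
    (∀ v w, g x v w = modelMetric e v w) ∧
    (J x (e 1) = -e 2 ∧ J x (e 2) = e 1 ∧ J x (e 3) = -e 4 ∧ J x (e 4) = e 3 ∧
      J x (e 5) = e 6 ∧ J x (e 6) = -e 5 ∧ J x (e 7) = e 0 ∧ J x (e 0) = -e 7) ∧
    (∀ v, omega x v = modelOmega e v) ∧ (∀ v, Omega x v = modelOmegaC e v)

namespace SU22Structure

variable (S : SU22Structure M)

/-- The `SU(2,2)` structure is integrable (torsion-free): some torsion-free connection preserves
it. Such a connection is the Levi-Civita connection of `g`; in particular it is unique, and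
automatically smooth. -/
def IsIntegrable : Prop :=
  ∃ cov : AffineConnection M, cov.torsion = 0 ∧ S.g.IsParallel cov ∧ S.J.IsParallel cov ∧
    S.omega.IsParallel cov ∧ S.Omega.IsParallel cov

/-- The complex Cayley form `Φ_τ = cosh(2τ) Re Ω + i sinh(2τ) Im Ω - ½ ω ∧ ω`. -/
def complexCayleyForm (τ : ℝ) : Form M 4 ℂ := fun x =>
  ((Real.cosh (2 * τ) : ℝ) : ℂ) • complexify (rePart (S.Omega x))
    + (Complex.I * ((Real.sinh (2 * τ) : ℝ) : ℂ)) • complexify (imPart (S.Omega x))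
    - (1 / 2 : ℂ) • complexify (wedge₂₂ (S.omega x) (S.omega x))

end SU22Structure

end Manifold

end

end SplitCayley

/-! Integrability of `SL(4,ℝ)` and `SU(2,2)` structures and closedness of their Cayley forms. -/

namespace SplitCayley

noncomputable section

open Function
open scoped Topology
open ContinuousAlternatingMap (alternatizeUncurryFin alternatizeUncurryFin_apply)

/-! ## The Lefschetz map on 3-forms -/

/-! Both structures are instances of one situation: a metric g, an endomorphism L with L² = ε, the
2-form w = g(L·,·), and complex-valued 4-forms P and Q on which L acts in each argument as λ and −λ,
where λ² = ε. For SL(4,ℝ) these are K, λ = 1, Ω₊ and Ω₋; for SU(2,2) they are J, λ = i, Ω and its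
conjugate. The pointwise relations are collected in `IsAdapted`, and every Cayley form is aP + bQ +
r w∧w with a ≠ b and r real and nonzero.

From one equation to three. Complex conjugation of dΦ = 0 exchanges a and b, because either P, Q are
real and b is the conjugate of a, or a, b are real and Q is the conjugate of P. Subtraction gives dP
= dQ. By type, dP only has components on which the derivation extending L has eigenvalue λ, 3λ or
5λ, while dQ has −λ, −3λ, −5λ; hence both vanish (`alternatize_eq_zero_of_eq`). Then 2 w∧dw = 0, and
wedging with a nondegenerate 2-form is injective on 3-forms in dimension 8
(`eq_zero_of_wedge₂₃_eq_zero`), so dw = 0.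

From closed to parallel. At a fixed point the Levi-Civita Christoffel symbols Γ are removed by the
change of frame 1 − Γ(z − y₀), after which g is constant to first order and exterior derivatives are
unchanged. Then `variation_eq_zero` applies: dP = dQ = 0 kills the Nijenhuis tensor, which together
with dw = 0 forces w and L to be parallel. The product P ⊗ Q is a determinant in g and w, so the
derivatives of P and Q are α ⊗ P and −α ⊗ Q; closedness makes α an eigencovector of L for both λ and
−λ, so α = 0.

A connection is determined pointwise by its Christoffel symbols, so the choices at different points
need no compatibility. Conversely, a parallel form of a torsion-free connection is closed, because
the symmetric Γ disappears under alternation. -/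

/-- The value of `ω ∧ χ` for a 2-form `ω` and a 3-form `χ`. -/
def wedge₂₃ {V : Type*} (w : V → V → ℝ) (χ : V → V → V → ℝ) (v₀ v₁ v₂ v₃ v₄ : V) : ℝ :=
  w v₀ v₁ * χ v₂ v₃ v₄ - w v₀ v₂ * χ v₁ v₃ v₄ + w v₀ v₃ * χ v₁ v₂ v₄ - w v₀ v₄ * χ v₁ v₂ v₃
    + w v₁ v₂ * χ v₀ v₃ v₄ - w v₁ v₃ * χ v₀ v₂ v₄ + w v₁ v₄ * χ v₀ v₂ v₃
    + w v₂ v₃ * χ v₀ v₁ v₄ - w v₂ v₄ * χ v₀ v₁ v₃ + w v₃ v₄ * χ v₀ v₁ v₂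

/-- Wedging with a symplectic form is injective on 3-forms in dimension 8. -/
theorem eq_zero_of_wedge₂₃_eq_zero {V : Type*} [AddCommGroup V] [Module ℝ V]
    {w : V → V → ℝ} {χ : V → V → V → ℝ}
    (hlin : ∀ y z, IsLinearMap ℝ fun x => χ x y z)
    (h₁₂ : ∀ x y z, χ x y z = -χ y x z) (h₂₃ : ∀ x y z, χ x y z = -χ x z y)
    {e f : Fin 8 → V} (he : ∀ x, ∑ a, w (e a) x • f a = x) (hf : ∀ x, ∑ a, w (f a) x • e a = -x)
    (htr : ∑ a, w (e a) (f a) = 8)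
    (h : ∀ v₀ v₁ v₂ v₃ v₄, wedge₂₃ w χ v₀ v₁ v₂ v₃ v₄ = 0) (x y z : V) : χ x y z = 0 := by
  have se : ∀ x y z, ∑ a, w (e a) x * χ (f a) y z = χ x y z := fun x y z => by
    have := congrArg (IsLinearMap.mk' _ (hlin y z)) (he x)
    simpa [map_sum] using this
  have sf : ∀ x y z, ∑ a, w (f a) x * χ (e a) y z = -χ x y z := fun x y z => by
    have := congrArg (IsLinearMap.mk' _ (hlin y z)) (hf x)
    rw [map_neg] at this
    simpa [map_sum] using this
  -- Contract w ∧ χ = 0 with ∑ eₐ ∧ fₐ. The trace contributes 8χ, and each of the three arguments of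
  -- χ gives back −χ once through eₐ and once through fₐ, whence 8 − 6 = 2.
  have key : ∀ x y z, 2 * χ x y z + (w x y * ∑ a, χ (e a) (f a) z
      - w x z * ∑ a, χ (e a) (f a) y + w y z * ∑ a, χ (e a) (f a) x) = 0 := fun x y z => by
    have h0 : ∑ a, wedge₂₃ w χ (e a) (f a) x y z = 0 := Finset.sum_eq_zero fun a _ => h ..
    simp only [wedge₂₃, Finset.sum_add_distrib, Finset.sum_sub_distrib, ← Finset.sum_mul,
      ← Finset.mul_sum, se, sf, htr] at h0
    linarith [h₁₂ x y z, h₂₃ x y z, h₁₂ y x z, h₂₃ y x z, h₁₂ z x y, h₂₃ z x y, h₁₂ x z y,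
      h₂₃ x z y, h₁₂ y z x, h₂₃ y z x]
  -- Contracting a second time gives (2 + 8 − 1 − 1) times the contracted 1-form, so that form
  -- vanishes and only 2χ = 0 remains.
  have sξ : ∀ z, ∑ a, χ (e a) (f a) z = 0 := fun z => by
    have h0 : ∑ b, (2 * χ (e b) (f b) z + (w (e b) (f b) * ∑ a, χ (e a) (f a) z
        - w (e b) z * ∑ a, χ (e a) (f a) (f b) + w (f b) z * ∑ a, χ (e a) (f a) (e b))) = 0 :=
      Finset.sum_eq_zero fun b _ => key ..
    have h1 : ∀ x, ∑ a, χ (e a) (f a) x = ∑ a, χ x (e a) (f a) := fun x =>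
      Finset.sum_congr rfl fun a _ => by rw [h₂₃, h₁₂, neg_neg]
    have h2 : ∑ b, w (e b) z * ∑ a, χ (e a) (f a) (f b) = ∑ a, χ (e a) (f a) z := by
      simp only [h1, Finset.mul_sum]
      rw [Finset.sum_comm]
      simp only [se]
    have h3 : ∑ b, w (f b) z * ∑ a, χ (e a) (f a) (e b) = -∑ a, χ (e a) (f a) z := by
      simp only [h1, Finset.mul_sum]
      rw [Finset.sum_comm]
      simp only [sf, Finset.sum_neg_distrib]
    simp only [Finset.sum_add_distrib, Finset.sum_sub_distrib, ← Finset.sum_mul, h2, h3, htr,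
      ← Finset.mul_sum] at h0
    linarith
  have := key x y z
  simp only [sξ] at this
  linarith

/-! ## The type decomposition of functions of several vectors -/

section SlotOperators

variable {V : Type*} {n : ℕ}

open Module

/-- Precomposition of the `j`-th argument with `L`. -/
def slotEnd (L : V → V) (j : Fin n) : End ℂ ((Fin n → V) → ℂ) :=
  LinearMap.funLeft ℂ ℂ fun x => update x j (L (x j))

@[simp] theorem slotEnd_apply (L : V → V) (j : Fin n) (f : (Fin n → V) → ℂ) (x : Fin n → V) :
    slotEnd L j f x = f (update x j (L (x j))) := rfl

theorem slotEnd_commute (L : V → V) (i j : Fin n) : Commute (slotEnd L i) (slotEnd L j) := by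
  refine LinearMap.ext fun f => funext fun x => ?_
  simp only [End.mul_apply, slotEnd_apply]
  rcases eq_or_ne i j with rfl | hij
  · rfl
  · rw [update_of_ne hij, update_of_ne hij.symm, update_comm hij]

/-- The derivation extending `L`. -/
def slotDerivation (n : ℕ) (L : V → V) : End ℂ ((Fin n → V) → ℂ) := ∑ j, slotEnd L j

theorem slotEnd_commute_slotDerivation (L : V → V) (i : Fin n) :
    Commute (slotEnd L i) (slotDerivation n L) :=
  Commute.sum_right _ _ _ fun j _ => slotEnd_commute L i j

end SlotOperators
-- Types occurring in the exterior derivative of a (4,0)-form.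
section Types

open Module

variable {E : Type*} [NormedAddCommGroup E] [NormedSpace ℝ E]

/-- `Ω` is a form of type `(4,0)` for the endomorphism `L` with eigenvalue `lam`, and `A`, `N` are
first order variations of `Ω` and `L` that preserve the type condition. -/
structure IsTypeVariation (lam : ℂ) (ε : ℝ) (L : E →L[ℝ] E) (N : E →L[ℝ] E →L[ℝ] E)
    (Ω : E [⋀^Fin 4]→L[ℝ] ℂ) (A : E →L[ℝ] E [⋀^Fin 4]→L[ℝ] ℂ) : Prop where
  sq_lam : lam * lam = ε
  sq_apply : ∀ x, L (L x) = ε • x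
  anticomm : ∀ u x, N u (L x) = -L (N u x)
  form_apply : ∀ v j, Ω (update v j (L (v j))) = lam * Ω v
  variation_apply : ∀ u v j,
    A u (update v j (L (v j))) + Ω (update v j (N u (v j))) = lam * A u v

namespace IsTypeVariation

variable {lam : ℂ} {ε : ℝ} {L : E →L[ℝ] E} {N : E →L[ℝ] E →L[ℝ] E}
  {Ω : E [⋀^Fin 4]→L[ℝ] ℂ} {A : E →L[ℝ] E [⋀^Fin 4]→L[ℝ] ℂ}

/-- The term of the exterior derivative in which the `k`-th vector differentiates. -/
def term (A : E →L[ℝ] E [⋀^Fin 4]→L[ℝ] ℂ) (k : Fin 5) (x : Fin 5 → E) : ℂ :=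
  A (x k) (k.removeNth x)

/-- The defect of `term` from having pure type in the differentiated arguments. -/
def defect (Ω : E [⋀^Fin 4]→L[ℝ] ℂ) (N : E →L[ℝ] E →L[ℝ] E) (k : Fin 5) (i : Fin 4)
    (x : Fin 5 → E) : ℂ :=
  Ω (update (k.removeNth x) i (N (x k) (k.removeNth x i)))

/-- The differentiating argument has no prescribed type; all that is known there is L² = ε, so L
acts in that slot with eigenvalues ±λ. -/
theorem slotEnd_self_sq_of_real_linear (h : IsTypeVariation lam ε L N Ω A) (k : Fin 5)
    {f : (Fin 5 → E) → ℂ} (hf : ∀ x (c : ℝ), f (update x k (c • x k)) = c * f x) :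
    slotEnd (L : E → E) k (slotEnd (L : E → E) k f) = (ε : ℂ) • f := by
  funext x
  simp [h.sq_apply, hf]

theorem slotEnd_self_sq_term (h : IsTypeVariation lam ε L N Ω A) (k : Fin 5) :
    slotEnd (L : E → E) k (slotEnd (L : E → E) k (term A k)) = (ε : ℂ) • term A k :=
  h.slotEnd_self_sq_of_real_linear k fun x c => by simp [term]

theorem slotEnd_self_sq_defect (h : IsTypeVariation lam ε L N Ω A) (k : Fin 5) (i : Fin 4) :
    slotEnd (L : E → E) k (slotEnd (L : E → E) k (defect Ω N k i)) = (ε : ℂ) • defect Ω N k i :=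
  h.slotEnd_self_sq_of_real_linear k fun x c => by
    simp [defect]

/-- This is the differentiated type condition: a covariant derivative of Ω is still of type (4,0) up
to the change N of L itself. -/
theorem slotEnd_term (h : IsTypeVariation lam ε L N Ω A) (k : Fin 5) (i : Fin 4) :
    slotEnd (L : E → E) (k.succAbove i) (term A k) = lam • term A k - defect Ω N k i := by
  funext x
  have := h.variation_apply (x k) (k.removeNth x) i
  simp only [slotEnd_apply, term, defect, Pi.sub_apply, Pi.smul_apply, smul_eq_mul, ← this,
    Fin.removeNth_update_succAbove, update_of_ne (Fin.ne_succAbove k i)]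
  simp [Fin.removeNth_apply]

/-- Since L² is constant, N anticommutes with L, so passing through N reverses the eigenvalue in
slot i. -/
theorem slotEnd_defect_self (h : IsTypeVariation lam ε L N Ω A) (k : Fin 5) (i : Fin 4) :
    slotEnd (L : E → E) (k.succAbove i) (defect Ω N k i) = -(lam • defect Ω N k i) := by
  funext x
  simp only [slotEnd_apply, defect, Pi.neg_apply, Pi.smul_apply, smul_eq_mul,
    Fin.removeNth_update_succAbove, update_of_ne (Fin.ne_succAbove k i), update_self,
    update_idem, h.anticomm]
  have hx : x (k.succAbove i) = k.removeNth x i := rfl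
  have := h.form_apply (update (k.removeNth x) i (N (x k) (x (k.succAbove i)))) i
  rw [update_idem, update_self] at this
  rw [← neg_one_smul ℝ (L _), ContinuousAlternatingMap.map_update_smul, ← hx, this]
  simp

theorem slotEnd_defect_of_ne (h : IsTypeVariation lam ε L N Ω A) (k : Fin 5) {i j : Fin 4}
    (hij : j ≠ i) :
    slotEnd (L : E → E) (k.succAbove j) (defect Ω N k i) = lam • defect Ω N k i := by
  funext x
  simp only [slotEnd_apply, defect, Pi.smul_apply, smul_eq_mul,
    Fin.removeNth_update_succAbove, update_of_ne (Fin.ne_succAbove k j), update_of_ne hij.symm]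
  rw [← h.form_apply _ j, update_of_ne hij, update_comm hij]
  simp [Fin.removeNth_apply]

/-- Of the four arguments of Ω three contribute λ and the one passed through N contributes −λ, in
total 2λ. -/
theorem slotDerivation_defect (h : IsTypeVariation lam ε L N Ω A) (k : Fin 5) (i : Fin 4) :
    slotDerivation 5 (L : E → E) (defect Ω N k i)
      = slotEnd (L : E → E) k (defect Ω N k i) + (2 * lam) • defect Ω N k i := by
  rw [slotDerivation, LinearMap.sum_apply, Fin.sum_univ_succAbove _ k,
    ← Finset.add_sum_erase _ _ (Finset.mem_univ i), h.slotEnd_defect_self,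
    Finset.sum_congr rfl fun j hj => h.slotEnd_defect_of_ne k (Finset.ne_of_mem_erase hj)]
  simp only [Finset.sum_const, Finset.card_erase_of_mem (Finset.mem_univ i), Finset.card_univ,
    Fintype.card_fin]
  module

theorem slotDerivation_term (h : IsTypeVariation lam ε L N Ω A) (k : Fin 5) :
    slotDerivation 5 (L : E → E) (term A k)
      = slotEnd (L : E → E) k (term A k) + (4 * lam) • term A k - ∑ i, defect Ω N k i := by
  rw [slotDerivation, LinearMap.sum_apply, Fin.sum_univ_succAbove _ k,
    Finset.sum_congr rfl fun i _ => h.slotEnd_term k i, Finset.sum_sub_distrib]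
  simp only [Finset.sum_const, Finset.card_univ, Fintype.card_fin]
  module

/-- Here D = S + 2λ with S the operator of slot k and S² = λ², so D has eigenvalues 3λ and λ. -/
theorem slotDerivation_defect_eq_zero (h : IsTypeVariation lam ε L N Ω A) (k : Fin 5)
    (i : Fin 4) :
    (slotDerivation 5 (L : E → E) - algebraMap ℂ _ lam)
      ((slotDerivation 5 (L : E → E) - algebraMap ℂ _ (3 * lam)) (defect Ω N k i)) = 0 := by
  have h1 := h.slotDerivation_defect k i
  have h2 := congrArg (slotEnd (L : E → E) k) h1
  have hc := LinearMap.congr_fun (slotEnd_commute_slotDerivation (n := 5) (L : E → E) k).eq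
    (defect Ω N k i)
  simp only [End.mul_apply] at hc
  rw [hc, map_add, map_smul, h.slotEnd_self_sq_defect, ← h.sq_lam] at h2
  simp only [LinearMap.sub_apply, map_sub, algebraMap_end_apply, map_smul, smul_sub]
  rw [h1, map_add, map_smul, h2, h1]
  module

/-- Modulo the total defect B, D acts as S + 4λ with S² = λ², with eigenvalues 5λ and 3λ. Keeping
track of B, (D − 3λ)(D − 5λ) sends the term to −2(D − 3λ)B, which D − λ annihilates. -/
theorem slotDerivation_term_eq_zero (h : IsTypeVariation lam ε L N Ω A) (k : Fin 5) :
    (slotDerivation 5 (L : E → E) - algebraMap ℂ _ lam)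
      ((slotDerivation 5 (L : E → E) - algebraMap ℂ _ (3 * lam))
        ((slotDerivation 5 (L : E → E) - algebraMap ℂ _ (5 * lam)) (term A k))) = 0 := by
  set D := slotDerivation 5 (L : E → E) with hD
  set B := ∑ i, defect Ω N k i with hB
  have hBD : D B = slotEnd (L : E → E) k B + (2 * lam) • B := by
    rw [hB, map_sum, map_sum, Finset.smul_sum, ← Finset.sum_add_distrib]
    exact Finset.sum_congr rfl fun i _ => h.slotDerivation_defect k i
  have hB0 : (D - algebraMap ℂ _ lam) ((D - algebraMap ℂ _ (3 * lam)) B) = 0 := by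
    simp only [hB, map_sum]
    exact Finset.sum_eq_zero fun i _ => h.slotDerivation_defect_eq_zero k i
  have h1 := h.slotDerivation_term k
  have h2 := congrArg (slotEnd (L : E → E) k) h1
  have hc := LinearMap.congr_fun (slotEnd_commute_slotDerivation (n := 5) (L : E → E) k).eq
    (term A k)
  simp only [End.mul_apply] at hc
  rw [hc, map_sub, map_add, map_smul, h.slotEnd_self_sq_term, ← h.sq_lam] at h2
  rw [← hD, ← hB] at h1 h2
  have h3 : (D - algebraMap ℂ _ (3 * lam)) ((D - algebraMap ℂ _ (5 * lam)) (term A k))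
      = -(2 : ℂ) • (D - algebraMap ℂ _ (3 * lam)) B := by
    simp only [LinearMap.sub_apply, map_sub, algebraMap_end_apply, map_smul, smul_sub]
    rw [h1, map_sub, map_add, map_smul, h2, h1, hBD]
    module
  rw [h3, map_smul, hB0, smul_zero]

/-- The exterior derivative of a form of type `(4,0)` has no components of type `(p,q)` with
`p < 3`. -/
theorem slotDerivation_alternatize_eq_zero (h : IsTypeVariation lam ε L N Ω A) :
    (slotDerivation 5 (L : E → E) - algebraMap ℂ _ lam)
      ((slotDerivation 5 (L : E → E) - algebraMap ℂ _ (3 * lam))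
        ((slotDerivation 5 (L : E → E) - algebraMap ℂ _ (5 * lam))
          (alternatizeUncurryFin A))) = 0 := by
  have : (alternatizeUncurryFin A : (Fin 5 → E) → ℂ) = ∑ k : Fin 5, ((-1 : ℂ) ^ (k : ℕ)) • term A k := by
    funext x
    simp only [alternatizeUncurryFin_apply, Finset.sum_apply, Pi.smul_apply, term]
    refine Finset.sum_congr rfl fun k _ => ?_
    rw [smul_eq_mul, zsmul_eq_mul]
    push_cast
    rfl
  simp only [this, map_sum, map_smul, h.slotDerivation_term_eq_zero, smul_zero,
    Finset.sum_const_zero]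

end IsTypeVariation

/-- If the exterior derivatives of forms of types `(4,0)` and `(0,4)` agree, they vanish. -/
theorem alternatize_eq_zero_of_eq {lam : ℂ} {ε : ℝ} {L : E →L[ℝ] E} {N : E →L[ℝ] E →L[ℝ] E}
    {Ωp Ωm : E [⋀^Fin 4]→L[ℝ] ℂ} {Ap Am : E →L[ℝ] E [⋀^Fin 4]→L[ℝ] ℂ} (hlam : lam ≠ 0)
    (hp : IsTypeVariation lam ε L N Ωp Ap) (hm : IsTypeVariation (-lam) ε L N Ωm Am)
    (h : alternatizeUncurryFin Ap = alternatizeUncurryFin Am) : alternatizeUncurryFin Ap = 0 := by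
  have h1 := hp.slotDerivation_alternatize_eq_zero
  have h2 := hm.slotDerivation_alternatize_eq_zero
  rw [← h] at h2
  set D := slotDerivation 5 (L : E → E)
  set f : (Fin 5 → E) → ℂ := ⇑(alternatizeUncurryFin Ap)
  have key : f = 0 := by
    -- The polynomials (X − λ)(X − 3λ)(X − 5λ) and (X + λ)(X + 3λ)(X + 5λ) both kill f and are
    -- coprime. Half their sum is X³ + 23λ²X and half their difference is 9λX² + 15λ³ up to sign;
    -- eliminating between them gives 192λ³ X, where 192 = 9·23 − 15.
    simp only [LinearMap.sub_apply, map_sub, algebraMap_end_apply, map_smul, smul_sub] at h1 h2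
    have e1 : D (D (D f)) + (23 * lam ^ 2) • D f = 0 := by
      linear_combination (norm := module) (1 / 2 : ℂ) • h1 + (1 / 2 : ℂ) • h2
    have e2 : (9 * lam) • D (D f) + (15 * lam ^ 3) • f = 0 := by
      linear_combination (norm := module) (-1 / 2 : ℂ) • h1 + (1 / 2 : ℂ) • h2
    have e3 := congrArg D e2
    simp only [map_add, map_smul, map_zero] at e3
    have e4 : (192 * lam ^ 3) • D f = 0 := by
      linear_combination (norm := module) (9 * lam) • e1 - e3
    have e5 : D f = 0 := (smul_eq_zero.1 e4).resolve_left (mul_ne_zero (by norm_num) (pow_ne_zero _ hlam))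
    rw [e5, map_zero, smul_zero, zero_add] at e2
    exact (smul_eq_zero.1 e2).resolve_left (mul_ne_zero (by norm_num) (pow_ne_zero _ hlam))
  ext x
  exact congrFun key x

end Types

/-! ### Pointwise argument: closed forms have zero covariant derivative. -/

section Integrability


variable {E : Type*} [NormedAddCommGroup E] [NormedSpace ℝ E]

theorem update_vec₂_one {V : Type*} (x y z : V) : update ![x, y] 1 z = ![x, z] := by
  ext i; fin_cases i <;> simp

theorem update_vec₄_zero {V : Type*} (x y z w t : V) :
    update ![x, y, z, w] 0 t = ![t, y, z, w] := by
  ext i; fin_cases i <;> simp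

theorem update_vec₄_one {V : Type*} (x y z w t : V) :
    update ![x, y, z, w] 1 t = ![x, t, z, w] := by
  ext i; fin_cases i <;> simp

theorem apply_vec₂_swap {F : Type*} [AddCommGroup F] [Module ℝ F] [TopologicalSpace F]
    (γ : E [⋀^Fin 2]→L[ℝ] F) (x y : E) : γ ![x, y] = -γ ![y, x] := by
  have e : ![y, x] ∘ Equiv.swap (0 : Fin 2) 1 = ![x, y] := by
    ext i; fin_cases i <;> simp
  have h : γ (![y, x] ∘ Equiv.swap (0 : Fin 2) 1) = -γ ![y, x] :=
    γ.toAlternatingMap.map_swap ![y, x] (i := 0) (j := 1) (by decide)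
  rwa [e] at h

theorem alternatize_apply_vec₅ {F : Type*} [NormedAddCommGroup F] [NormedSpace ℝ F]
    (A : E →L[ℝ] E [⋀^Fin 4]→L[ℝ] F) (u v a b c : E) :
    alternatizeUncurryFin A ![u, v, a, b, c]
      = A u ![v, a, b, c] - A v ![u, a, b, c] + A a ![u, v, b, c] - A b ![u, v, a, c]
        + A c ![u, v, a, b] := by
  have e : ∀ k : Fin 5, k.removeNth ![u, v, a, b, c] = (![![v, a, b, c], ![u, a, b, c],
      ![u, v, b, c], ![u, v, a, c], ![u, v, a, b]] : Fin 5 → Fin 4 → E) k := fun k => by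
    ext i; fin_cases k <;> fin_cases i <;> rfl
  rw [alternatizeUncurryFin_apply]
  refine (Fin.sum_univ_five _).trans ?_
  rw [e, e, e, e, e]
  simp [pow_succ, sub_eq_add_neg]

theorem alternatize_apply_vec₃ {F : Type*} [NormedAddCommGroup F] [NormedSpace ℝ F]
    (n : E →L[ℝ] E [⋀^Fin 2]→L[ℝ] F) (u v w : E) :
    alternatizeUncurryFin n ![u, v, w] = n u ![v, w] - n v ![u, w] + n w ![u, v] := by
  have e : ∀ k : Fin 3, k.removeNth ![u, v, w] = (![![v, w], ![u, w], ![u, v]] :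
      Fin 3 → Fin 2 → E) k := fun k => by
    ext i; fin_cases k <;> fin_cases i <;> rfl
  rw [alternatizeUncurryFin_apply]
  refine (Fin.sum_univ_three _).trans ?_
  rw [e, e, e]
  simp [pow_succ, sub_eq_add_neg]

namespace IsTypeVariation

variable {lam : ℂ} {ε : ℝ} {L : E →L[ℝ] E} {N : E →L[ℝ] E →L[ℝ] E}
  {Ω : E [⋀^Fin 4]→L[ℝ] ℂ} {A : E →L[ℝ] E [⋀^Fin 4]→L[ℝ] ℂ}

/-- A closed form of type `(4,0)` annihilates the Nijenhuis tensor. -/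
theorem apply_nijenhuis_eq_zero (h : IsTypeVariation lam ε L N Ω A)
    (hA : alternatizeUncurryFin A = 0) (u v a b c : E) :
    Ω ![(L (N u v) - N (L u) v) - (L (N v u) - N (L v) u), a, b, c] = 0 := by
  have o0 : ∀ x a b c, Ω ![L x, a, b, c] = lam * Ω ![x, a, b, c] := fun x a b c => by
    simpa [update_vec₄_zero] using h.form_apply ![x, a, b, c] 0
  have o1 : ∀ x a b c, Ω ![x, L a, b, c] = lam * Ω ![x, a, b, c] := fun x a b c => by
    simpa [update_vec₄_one] using h.form_apply ![x, a, b, c] 1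
  have s0 : ∀ u x a b c, A u ![L x, a, b, c] = lam * A u ![x, a, b, c] - Ω ![N u x, a, b, c] :=
    fun u x a b c => by
      rw [eq_sub_iff_add_eq]
      simpa [update_vec₄_zero] using h.variation_apply u ![x, a, b, c] 0
  have s1 : ∀ u x a b c, A u ![x, L a, b, c] = lam * A u ![x, a, b, c] - Ω ![x, N u a, b, c] :=
    fun u x a b c => by
      rw [eq_sub_iff_add_eq]
      simpa [update_vec₄_one] using h.variation_apply u ![x, a, b, c] 1
  have hsub : ∀ x y, Ω ![x - y, a, b, c] = Ω ![x, a, b, c] - Ω ![y, a, b, c] := fun x y => by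
    simpa [update_vec₄_zero] using Ω.map_update_sub ![x, a, b, c] 0 x y
  have F : ∀ u v, A u ![v, a, b, c] - A v ![u, a, b, c] + A a ![u, v, b, c] - A b ![u, v, a, c]
        + A c ![u, v, a, b] = 0 := fun u v => by
    rw [← alternatize_apply_vec₅, hA]; rfl
  -- Apply L − λ in the first two arguments of dΩ = 0. Terms differentiated along a, b or c vanish,
  -- because one application removes the derivative and the other then annihilates Ω; only terms in
  -- N with u, v survive.
  have h1 := F (L u) (L v)
  have h2 := F u (L v)
  have h3 := F (L u) v
  have h4 := F u v
  simp only [s0, s1, o1] at h1 h2 h3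
  simp only [hsub, o0]
  linear_combination h1 - lam * h2 - lam * h3 + lam ^ 2 * h4

/-- If the derivative of a closed form of type `(4,0)` is `α ⊗ Ω` then `α` is of type `(1,0)`. -/
theorem connectionForm_apply (h : IsTypeVariation lam ε L N Ω A) (hA : alternatizeUncurryFin A = 0)
    {α : E → ℂ} (hα : ∀ u v, A u v = α u * Ω v) (hΩ : Ω ≠ 0) (u : E) :
    α (L u) = lam * α u := by
  obtain ⟨y, hy⟩ : ∃ y, Ω y ≠ 0 := by
    by_contra! H
    exact hΩ (by ext y; simpa using H y)
  have ey : y = ![y 0, y 1, y 2, y 3] := by ext i; fin_cases i <;> rfl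
  have o0 : ∀ x a b c, Ω ![L x, a, b, c] = lam * Ω ![x, a, b, c] := fun x a b c => by
    simpa [update_vec₄_zero] using h.form_apply ![x, a, b, c] 0
  have F := fun u => alternatize_apply_vec₅ A u (y 0) (y 1) (y 2) (y 3)
  -- In α ∧ Ω = 0, replacing u by L u multiplies every term by λ except the one in which α is
  -- applied to u.
  have h1 := F (L u)
  have h2 := F u
  simp only [hA, ContinuousAlternatingMap.coe_zero, Pi.zero_apply, hα, o0, ← ey] at h1 h2
  refine mul_right_cancel₀ hy ?_
  linear_combination lam * h2 - h1

end IsTypeVariation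

/-- A structure whose fundamental 2-form and 4-forms are closed is parallel. All variations are
relative to a torsion-free connection preserving `g`. -/
theorem variation_eq_zero {lam : ℂ} {ε : ℝ} {L : E →L[ℝ] E} {N : E →L[ℝ] E →L[ℝ] E}
    {Ωp Ωm : E [⋀^Fin 4]→L[ℝ] ℂ} {Ap Am : E →L[ℝ] E [⋀^Fin 4]→L[ℝ] ℂ}
    {g : E →L[ℝ] E →L[ℝ] ℝ} {n : E →L[ℝ] E [⋀^Fin 2]→L[ℝ] ℝ} (hε : ε ≠ 0)
    (hp : IsTypeVariation lam ε L N Ωp Ap) (hm : IsTypeVariation (-lam) ε L N Ωm Am)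
    (hp0 : Ωp ≠ 0) (hm0 : Ωm ≠ 0)
    (hinj : ∀ x, (∀ a b c, Ωp ![x, a, b, c] = 0) → (∀ a b c, Ωm ![x, a, b, c] = 0) → x = 0)
    (hgL : ∀ x y, g (L x) y = -g x (L y)) (hn : ∀ u x y, n u ![x, y] = g (N u x) y)
    (hdet : n = 0 → ∀ u y x, Ap u y * Ωm x + Ωp y * Am u x = 0)
    (hdn : alternatizeUncurryFin n = 0) (hdp : alternatizeUncurryFin Ap = 0)
    (hdm : alternatizeUncurryFin Am = 0) : n = 0 ∧ Ap = 0 ∧ Am = 0 := by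
  have hlam : lam ≠ 0 := fun h => hε (by
    have := hp.sq_lam
    rw [h, zero_mul] at this
    exact_mod_cast this.symm)
  have nskew : ∀ u x y, g (N u x) y = -g (N u y) x := fun u x y => by
    rw [← hn, ← hn, apply_vec₂_swap]
  -- The antisymmetric part of (u, v) ↦ Q_u v, with Q_u = L N_u − N_{Lu}, is annihilated by both
  -- 4-forms, which have no common kernel.
  have Qsymm : ∀ u v, L (N u v) - N (L u) v = L (N v u) - N (L v) u := fun u v => by
    rw [← sub_eq_zero]
    exact hinj _ (hp.apply_nijenhuis_eq_zero hdp u v) (hm.apply_nijenhuis_eq_zero hdm u v)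
  have LN : ∀ u v w, g (L (N u v)) w = -g (L (N u w)) v := fun u v w => by
    rw [hgL, nskew, ← neg_neg (L (N u w)), ← hp.anticomm, map_neg, neg_apply]
  have Qskew : ∀ u v w, g (L (N u v) - N (L u) v) w = -g (L (N u w) - N (L u) w) v :=
    fun u v w => by
      simp only [map_sub, sub_apply]
      rw [LN u v w, nskew (L u) v w]; ring
  -- The trilinear form g(Q_u v, w) is symmetric in u, v and skew in v, w; such a form is zero.
  have Q0 : ∀ u v w, g (L (N u v)) w = g (N (L u) v) w := fun u v w => by
    have h1 := Qskew u v w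
    have h2 := Qskew w u v
    have h3 := Qskew v w u
    rw [Qsymm w u] at h2
    rw [Qsymm v w] at h3
    rw [Qsymm v u] at h3
    have h4 : g (L (N u v) - N (L u) v) w = 0 := by linarith
    rw [map_sub, sub_apply] at h4
    linarith
  have cyc : ∀ u v w, g (N u v) w + g (N v w) u + g (N w u) v = 0 := fun u v w => by
    have := alternatize_apply_vec₃ n u v w
    rw [hdn, ContinuousAlternatingMap.coe_zero, Pi.zero_apply] at this
    simp only [hn] at this
    rw [nskew v w u]
    linarith
  -- Replacing v, w by L v, L w in the cyclic identity multiplies its first term by ε and the other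
  -- two by −ε, so a comparison isolates the first term.
  have n0 : ∀ u v w, g (N u v) w = 0 := fun u v w => by
    have h1 := cyc u v w
    have h2 := cyc u (L v) (L w)
    have e1 : g (N u (L v)) (L w) = ε * g (N u v) w := by
      rw [hp.anticomm, map_neg, neg_apply, hgL, hp.sq_apply, map_smul,
        smul_eq_mul]; ring
    have e2 : g (N (L v) (L w)) u = -(ε * g (N v w) u) := by
      rw [← Q0, hp.anticomm, map_neg, map_neg, neg_apply, hp.sq_apply,
        map_smul, smul_apply, smul_eq_mul]
    have e3 : g (N (L w) u) (L v) = -(ε * g (N w u) v) := by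
      rw [← Q0, hgL, hp.sq_apply, map_smul, smul_eq_mul]
    rw [e1, e2, e3] at h2
    have h3 : ε * (2 * g (N u v) w) = 0 := by linear_combination h2 + ε * h1
    have := (mul_eq_zero.1 h3).resolve_left hε
    linarith
  have hn0 : n = 0 := by
    ext u x
    have ex : x = ![x 0, x 1] := by ext i; fin_cases i <;> rfl
    rw [ex, hn, n0]; rfl
  obtain ⟨x₀, hx₀⟩ : ∃ x, Ωm x ≠ 0 := by
    by_contra! H
    exact hm0 (by ext y; simpa using H y)
  obtain ⟨y₀, hy₀⟩ : ∃ y, Ωp y ≠ 0 := by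
    by_contra! H
    exact hp0 (by ext y; simpa using H y)
  -- With n = 0 the product Ωp ⊗ Ωm has zero derivative, so the two logarithmic derivatives are
  -- opposite covectors; evaluation at x₀ determines α.
  set α : E → ℂ := fun u => -(Am u x₀ / Ωm x₀) with hα
  have hAp : ∀ u y, Ap u y = α u * Ωp y := fun u y => by
    have := hdet hn0 u y x₀
    rw [hα]; field_simp
    linear_combination this
  have hAm : ∀ u x, Am u x = -α u * Ωm x := fun u x => by
    have := hdet hn0 u y₀ x
    rw [hAp] at this
    refine mul_left_cancel₀ hy₀ ?_
    linear_combination this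
  -- Closedness of the first form gives α(Lu) = λ α(u), closedness of the second gives α(Lu) = −λ
  -- α(u).
  have α0 : ∀ u, α u = 0 := fun u => by
    have h1 := hp.connectionForm_apply hdp hAp hp0 u
    have h2 := hm.connectionForm_apply hdm (α := fun u => -α u) hAm hm0 u
    have : 2 * lam * α u = 0 := by linear_combination -h1 - h2
    exact (mul_eq_zero.1 this).resolve_left (mul_ne_zero two_ne_zero hlam)
  refine ⟨hn0, ?_, ?_⟩
  · ext u y; simp [hAp, α0]
  · ext u y; simp [hAm, α0]

end Integrability
/-! ## Calculus of forms evaluated on vector fields -/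

section Calculus

variable {E G H : Type*} [NormedAddCommGroup E] [NormedSpace ℝ E] [NormedAddCommGroup G]
  [NormedSpace ℝ G] [NormedAddCommGroup H] [NormedSpace ℝ H]

/-- The product rule for a form evaluated on vector fields. -/
theorem exists_hasFDerivAt_form_apply {ι : Type*} [Fintype ι] [DecidableEq ι]
    {f : E → G [⋀^ι]→L[ℝ] H} {f' : E →L[ℝ] G [⋀^ι]→L[ℝ] H} {V : E → ι → G}
    {V' : ι → E →L[ℝ] G} {x : E} (hf : HasFDerivAt f f' x)
    (hV : ∀ i, HasFDerivAt (fun z => V z i) (V' i) x) :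
    ∃ D : E →L[ℝ] H, HasFDerivAt (fun z => f z (V z)) D x ∧
      ∀ u, D u = f' u (V x) + ∑ i, f x (update (V x) i (V' i u)) := by
  have h1 := (ContinuousAlternatingMap.toContinuousMultilinearMapCLM ℝ (ι := ι) (E := G)
    (F := H) (𝕜 := ℝ)).hasFDerivAt.comp x hf
  have h2 := fun i => (ContinuousLinearMap.toSpanSingletonCLE (𝕜 := ℝ) (E := G) :
    G →L[ℝ] ℝ →L[ℝ] G).hasFDerivAt.comp x (hV i)
  have h3 := h1.continuousMultilinearMapCompContinuousLinearMap h2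
  have h4 := ((ContinuousMultilinearMap.apply ℝ (fun _ : ι => ℝ) H (fun _ => (1 : ℝ))).hasFDerivAt).comp
    x h3
  refine ⟨_, h4.congr_of_eventuallyEq (Filter.Eventually.of_forall fun z => ?_), fun u => ?_⟩
  · simp
  · simp only [ContinuousLinearMap.comp_apply, add_apply]
    simp
    refine Finset.sum_congr rfl fun i _ => congrArg _ (funext fun j => ?_)
    rcases eq_or_ne j i with rfl | h
    · simp
    · simp [h]

/-- The determinant as a function of the entries is differentiable. -/
theorem differentiable_det {n : ℕ} :
    Differentiable ℝ fun m : Fin n → Fin n → ℂ => Matrix.det (Matrix.of m) := by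
  simp only [Matrix.det_apply', Matrix.of_apply]
  fun_prop

end Calculus

/-! ## Adapted tensors -/

/-- The algebraic relations between the tensors of an `SL(4,ℝ)` or `SU(2,2)` structure, where `P`
and `Q` are the 4-forms on which `L` acts with eigenvalues `lam` and `-lam`. -/
structure IsAdapted {V : Type*} [AddCommGroup V] [Module ℝ V] (lam : ℂ) (ε : ℝ) (c : ℂ)
    (g : V → V → ℝ) (L : V → V) (w : (Fin 2 → V) → ℝ) (P Q : (Fin 4 → V) → ℂ) : Prop where
  sq_apply : ∀ x, L (L x) = ε • x
  two_form_apply : ∀ x y, w ![x, y] = g (L x) y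
  symm : ∀ x y, g x y = g y x
  nondeg : ∀ x, (∀ y, g x y = 0) → x = 0
  type_P : ∀ v j, P (update v j (L (v j))) = lam * P v
  type_Q : ∀ v j, Q (update v j (L (v j))) = -lam * Q v
  ne_P : ∃ v, P v ≠ 0
  ne_Q : ∃ v, Q v ≠ 0
  inj : ∀ x, (∀ a b c, P ![x, a, b, c] = 0) → (∀ a b c, Q ![x, a, b, c] = 0) → x = 0
  -- The bilinear form λg + w pairs λ-eigencovectors with (−λ)-eigencovectors. Its determinant ties
  -- the scale of P to that of Q through g and w, which the type conditions alone leave free.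
  det : ∀ y x, P y * Q x
    = c * Matrix.det (Matrix.of fun i j => lam * (g (y i) (x j) : ℂ) + (w ![y i, x j] : ℂ))

/-- Adapted tensors pull back under linear isomorphisms. -/
theorem IsAdapted.comp {V W : Type*} [AddCommGroup V] [Module ℝ V] [AddCommGroup W] [Module ℝ W]
    {lam : ℂ} {ε : ℝ} {c : ℂ} {g : V → V → ℝ} {L : V → V} {w : (Fin 2 → V) → ℝ}
    {P Q : (Fin 4 → V) → ℂ} (h : IsAdapted lam ε c g L w P Q) (φ : W ≃ₗ[ℝ] V) :
    IsAdapted lam ε c (fun x y => g (φ x) (φ y)) (fun x => φ.symm (L (φ x)))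
      (fun v => w fun i => φ (v i)) (fun v => P fun i => φ (v i)) (fun v => Q fun i => φ (v i)) where
  sq_apply x := by simp [h.sq_apply]
  two_form_apply x y := by
    rw [φ.apply_symm_apply, ← h.two_form_apply]
    congr 1; ext i; fin_cases i <;> rfl
  symm x y := h.symm _ _
  nondeg x hx := by
    have := h.nondeg (φ x) fun y => by simpa using hx (φ.symm y)
    simpa using this
  type_P v j := by
    rw [← h.type_P _ j]
    congr 1; ext i
    rcases eq_or_ne i j with rfl | hij
    · simp
    · simp [hij]
  type_Q v j := by
    rw [← h.type_Q _ j]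
    congr 1; ext i
    rcases eq_or_ne i j with rfl | hij
    · simp
    · simp [hij]
  ne_P := by
    obtain ⟨v, hv⟩ := h.ne_P
    exact ⟨fun i => φ.symm (v i), by simpa using hv⟩
  ne_Q := by
    obtain ⟨v, hv⟩ := h.ne_Q
    exact ⟨fun i => φ.symm (v i), by simpa using hv⟩
  inj x hP hQ := by
    have e : ∀ a b c, (![φ x, a, b, c] : Fin 4 → V)
        = fun i => φ (![x, φ.symm a, φ.symm b, φ.symm c] i) := fun a b c => by
      ext i; fin_cases i <;> simp
    have := h.inj (φ x) (fun a b c => by rw [e]; exact hP ..) (fun a b c => by rw [e]; exact hQ ..)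
    simpa using this
  det y x := by
    rw [h.det]
    congr 3; ext i j; congr 3
    ext k; fin_cases k <;> rfl

/-- The endomorphism of an adapted structure is skew. -/
theorem IsAdapted.apply_left {V : Type*} [AddCommGroup V] [Module ℝ V] {lam : ℂ} {ε : ℝ} {c : ℂ}
    {g : V → V → ℝ} {L : V → V} {w : V [⋀^Fin 2]→ₗ[ℝ] ℝ}
    {P Q : (Fin 4 → V) → ℂ} (h : IsAdapted lam ε c g L w P Q) (x y : V) :
    g (L x) y = -g x (L y) := by
  have e : ![y, x] ∘ Equiv.swap (0 : Fin 2) 1 = ![x, y] := by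
    ext i; fin_cases i <;> simp
  have hs := w.map_swap ![y, x] (i := 0) (j := 1) (by decide)
  rw [e, h.two_form_apply, h.two_form_apply] at hs
  rw [hs, h.symm x]

/-! ### Germs of adapted tensor fields and their first derivatives. -/

section Jets

variable {E : Type*} [NormedAddCommGroup E] [NormedSpace ℝ E]

/-- Tensor fields on a vector space, differentiable at `y₀` and adapted near `y₀`. -/
structure AdaptedGerm (lam : ℂ) (ε : ℝ) (c : ℂ) (y₀ : E) (g : E → E →L[ℝ] E →L[ℝ] ℝ)
    (L : E → E →L[ℝ] E) (w : E → E [⋀^Fin 2]→L[ℝ] ℝ) (P Q : E → E [⋀^Fin 4]→L[ℝ] ℂ) :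
    Prop where
  sq_lam : lam * lam = ε
  ne_zero : ε ≠ 0
  diff_g : DifferentiableAt ℝ g y₀
  diff_L : DifferentiableAt ℝ L y₀
  diff_w : DifferentiableAt ℝ w y₀
  diff_P : DifferentiableAt ℝ P y₀
  diff_Q : DifferentiableAt ℝ Q y₀
  adapted : ∀ᶠ z in 𝓝 y₀, IsAdapted lam ε c (fun x y => g z x y) (L z) (w z) (P z) (Q z)

/-- Differentiating the type condition. -/
theorem isTypeVariation_fderiv {lam : ℂ} {ε : ℝ} {y₀ : E} {L : E → E →L[ℝ] E}
    {P : E → E [⋀^Fin 4]→L[ℝ] ℂ} (hlam : lam * lam = ε) (hL : DifferentiableAt ℝ L y₀)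
    (hP : DifferentiableAt ℝ P y₀) (h₁ : ∀ᶠ z in 𝓝 y₀, ∀ x, L z (L z x) = ε • x)
    (h₂ : ∀ᶠ z in 𝓝 y₀, ∀ v j, P z (update v j (L z (v j))) = lam * P z v) :
    IsTypeVariation lam ε (L y₀) (fderiv ℝ L y₀) (P y₀) (fderiv ℝ P y₀) where
  sq_lam := hlam
  sq_apply := h₁.self_of_nhds
  anticomm u x := by
    have d1 := hL.hasFDerivAt.clm_apply (hL.hasFDerivAt.clm_apply (hasFDerivAt_const x y₀))
    have d2 : HasFDerivAt (fun _ : E => ε • x) (0 : E →L[ℝ] E) y₀ := hasFDerivAt_const _ _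
    have := congrArg (· u) ((d1.congr_of_eventuallyEq (h₁.mono fun z hz => (hz x).symm)).unique d2)
    simp at this
    exact eq_neg_of_add_eq_zero_right this
  form_apply := h₂.self_of_nhds
  variation_apply u v j := by
    have hV : ∀ i, HasFDerivAt (fun z => update v j (L z (v j)) i)
        (if i = j then (fderiv ℝ L y₀).flip (v j) else 0) y₀ := fun i => by
      rcases eq_or_ne i j with rfl | hij
      · simp only [update_self, if_true]
        simpa using hL.hasFDerivAt.clm_apply (hasFDerivAt_const (v i) y₀)
      · simpa [hij] using hasFDerivAt_const (v i) y₀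
    obtain ⟨D, hD, hDu⟩ := exists_hasFDerivAt_form_apply hP.hasFDerivAt hV
    have d2 := (hP.hasFDerivAt.continuousAlternatingMap_apply_const v).const_mul lam
    have := congrArg (· u) ((hD.congr_of_eventuallyEq (h₂.mono fun z hz => (hz v j).symm)).unique d2)
    simp only [hDu] at this
    rw [Finset.sum_eq_single j] at this
    · simpa using this
    · intro i _ hij
      simp only [hij, if_false]
      exact (P y₀).map_coord_zero i (by simp)
    · simp

namespace AdaptedGerm

variable {lam : ℂ} {ε : ℝ} {c : ℂ} {y₀ : E} {g : E → E →L[ℝ] E →L[ℝ] ℝ}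
    {L : E → E →L[ℝ] E} {w : E → E [⋀^Fin 2]→L[ℝ] ℝ} {P Q : E → E [⋀^Fin 4]→L[ℝ] ℂ}

theorem isTypeVariation_P (h : AdaptedGerm lam ε c y₀ g L w P Q) :
    IsTypeVariation lam ε (L y₀) (fderiv ℝ L y₀) (P y₀) (fderiv ℝ P y₀) :=
  isTypeVariation_fderiv h.sq_lam h.diff_L h.diff_P (h.adapted.mono fun _ hz => hz.sq_apply)
    (h.adapted.mono fun _ hz => hz.type_P)

theorem isTypeVariation_Q (h : AdaptedGerm lam ε c y₀ g L w P Q) :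
    IsTypeVariation (-lam) ε (L y₀) (fderiv ℝ L y₀) (Q y₀) (fderiv ℝ Q y₀) :=
  isTypeVariation_fderiv (by simpa using h.sq_lam) h.diff_L h.diff_Q
    (h.adapted.mono fun _ hz => hz.sq_apply) (h.adapted.mono fun _ hz => hz.type_Q)

theorem lam_ne_zero (h : AdaptedGerm lam ε c y₀ g L w P Q) : lam ≠ 0 := fun h0 => h.ne_zero (by
  have := h.sq_lam
  rw [h0, zero_mul] at this
  exact_mod_cast this.symm)

/-- If the exterior derivatives of the two 4-forms agree, they vanish. -/
theorem extDeriv_eq_zero_of_eq (h : AdaptedGerm lam ε c y₀ g L w P Q)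
    (hd : extDeriv P y₀ = extDeriv Q y₀) : extDeriv P y₀ = 0 :=
  alternatize_eq_zero_of_eq h.lam_ne_zero h.isTypeVariation_P h.isTypeVariation_Q hd

/-- The integrability theorem for a germ whose metric is constant to first order. -/
theorem fderiv_eq_zero (h : AdaptedGerm lam ε c y₀ g L w P Q) (hg : fderiv ℝ g y₀ = 0)
    (hw : extDeriv w y₀ = 0) (hP : extDeriv P y₀ = 0) (hQ : extDeriv Q y₀ = 0) :
    fderiv ℝ L y₀ = 0 ∧ fderiv ℝ w y₀ = 0 ∧ fderiv ℝ P y₀ = 0 ∧ fderiv ℝ Q y₀ = 0 := by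
  have h0 := h.adapted.self_of_nhds
  have hg' : HasFDerivAt g 0 y₀ := hg ▸ h.diff_g.hasFDerivAt
  have hn : ∀ u x y, fderiv ℝ w y₀ u ![x, y] = g y₀ (fderiv ℝ L y₀ u x) y := fun u x y => by
    have d1 := h.diff_w.hasFDerivAt.continuousAlternatingMap_apply_const ![x, y]
    have d2 := (hg'.clm_apply (h.diff_L.hasFDerivAt.clm_apply (hasFDerivAt_const x y₀))).clm_apply
      (hasFDerivAt_const y y₀)
    have := congrArg (· u) ((d1.congr_of_eventuallyEq
      (h.adapted.mono fun z hz => (hz.two_form_apply x y).symm)).unique d2)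
    simpa using this
  -- When g and w are constant to first order, so is the determinant equal to P ⊗ Q; the product
  -- rule gives the relation.
  have hdet : fderiv ℝ w y₀ = 0 → ∀ u y x,
      fderiv ℝ P y₀ u y * Q y₀ x + P y₀ y * fderiv ℝ Q y₀ u x = 0 := fun hw0 u y x => by
    have hw' : HasFDerivAt w 0 y₀ := hw0 ▸ h.diff_w.hasFDerivAt
    have d1 := (h.diff_P.hasFDerivAt.continuousAlternatingMap_apply_const y).mul
      (h.diff_Q.hasFDerivAt.continuousAlternatingMap_apply_const x)
    have dm : HasFDerivAt (fun z => fun i j : Fin 4 =>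
        lam * (g z (y i) (x j) : ℂ) + (w z ![y i, x j] : ℂ))
        (0 : E →L[ℝ] Fin 4 → Fin 4 → ℂ) y₀ := by
      refine hasFDerivAt_pi'.2 fun i => hasFDerivAt_pi'.2 fun j => ?_
      have e1 := (hg'.clm_apply (hasFDerivAt_const (y i) y₀)).clm_apply (hasFDerivAt_const (x j) y₀)
      have e2 := hw'.continuousAlternatingMap_apply_const ![y i, x j]
      have e3 := ((Complex.ofRealCLM.hasFDerivAt.comp y₀ e1).const_mul lam).add
        (Complex.ofRealCLM.hasFDerivAt.comp y₀ e2)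
      refine e3.congr_fderiv ?_
      ext v
      simp
    have d2 := (((differentiable_det _).hasFDerivAt.comp y₀ dm).const_mul c)
    have := congrArg (· u) ((d1.congr_of_eventuallyEq
      (h.adapted.mono fun z hz => (hz.det y x).symm)).unique d2)
    simp at this
    linear_combination this
  have hPne : P y₀ ≠ 0 := fun H => by
    obtain ⟨v, hv⟩ := h0.ne_P
    exact hv (by rw [H]; rfl)
  have hQne : Q y₀ ≠ 0 := fun H => by
    obtain ⟨v, hv⟩ := h0.ne_Q
    exact hv (by rw [H]; rfl)
  obtain ⟨hw0, hP0, hQ0⟩ := variation_eq_zero h.ne_zero h.isTypeVariation_P h.isTypeVariation_Q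
    hPne hQne h0.inj (IsAdapted.apply_left (w := (w y₀).toAlternatingMap) h0) hn hdet hw hP hQ
  refine ⟨?_, hw0, hP0, hQ0⟩
  -- Since w = g(L·,·) and g is constant to first order, the derivative of L is recovered from that
  -- of w by nondegeneracy.
  ext u x : 2
  refine h0.nondeg _ fun y => ?_
  rw [← hn, hw0]
  rfl

end AdaptedGerm

end Jets

/-! ### Removing the Levi-Civita symbols by a change of frame. -/

section Connection

variable {E : Type*} [NormedAddCommGroup E] [NormedSpace ℝ E]

/-- The Christoffel symbols of the Levi-Civita connection at a point. -/
theorem exists_leviCivita [FiniteDimensional ℝ E] {g : E →L[ℝ] E →L[ℝ] ℝ}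
    (hnd : ∀ x, (∀ y, g x y = 0) → x = 0) (hsymm : ∀ x y, g x y = g y x)
    {g' : E →L[ℝ] E →L[ℝ] E →L[ℝ] ℝ} (hg' : ∀ u x y, g' u x y = g' u y x) :
    ∃ Γ : E →L[ℝ] E →L[ℝ] E, (∀ u v, Γ u v = Γ v u) ∧
      ∀ u x y, g' u x y = g (Γ u x) y + g x (Γ u y) := by
  have hinj : Injective (g : E →ₗ[ℝ] E →L[ℝ] ℝ) := by
    rw [← LinearMap.ker_eq_bot, LinearMap.ker_eq_bot']
    intro x hx
    exact hnd x fun y => congrArg (· y) hx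
  have hfr : Module.finrank ℝ E = Module.finrank ℝ (E →L[ℝ] ℝ) := by
    rw [← (LinearMap.toContinuousLinearMap : (E →ₗ[ℝ] ℝ) ≃ₗ[ℝ] E →L[ℝ] ℝ).finrank_eq]
    exact (Subspace.dual_finrank_eq (K := ℝ) (V := E)).symm
  have : FiniteDimensional ℝ (E →L[ℝ] ℝ) :=
    (LinearMap.toContinuousLinearMap : (E →ₗ[ℝ] ℝ) ≃ₗ[ℝ] E →L[ℝ] ℝ).finiteDimensional
  let e : E ≃ₗ[ℝ] (E →L[ℝ] ℝ) := LinearEquiv.ofInjectiveOfFinrankEq _ hinj hfr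
  have he : ∀ ℓ y, g (e.symm ℓ) y = ℓ y := fun ℓ y =>
    congrArg (· y) (e.apply_symm_apply ℓ)
  -- Koszul formula for constant fields, whose brackets vanish; Γ is obtained by raising the index
  -- with g.
  let ℓ : E → E → E →L[ℝ] ℝ := fun u v =>
    (1 / 2 : ℝ) • (g' u v + g' v u - (g'.flip u).flip v)
  have hℓ : ∀ u v y, ℓ u v y = (1 / 2 : ℝ) * (g' u v y + g' v u y - g' y u v) := fun u v y => by
    simp [ℓ]
  let Γ₀ : E →ₗ[ℝ] E →ₗ[ℝ] E := LinearMap.mk₂ ℝ (fun u v => e.symm (ℓ u v))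
    (fun u u' v => by rw [← map_add]; congr 1; ext y; simp [hℓ]; ring)
    (fun a u v => by rw [← map_smul]; congr 1; ext y; simp [hℓ]; ring)
    (fun u v v' => by rw [← map_add]; congr 1; ext y; simp [hℓ]; ring)
    (fun a u v => by rw [← map_smul]; congr 1; ext y; simp [hℓ]; ring)
  let Γ : E →L[ℝ] E →L[ℝ] E := LinearMap.toContinuousLinearMap
    ((LinearMap.toContinuousLinearMap : (E →ₗ[ℝ] E) ≃ₗ[ℝ] E →L[ℝ] E).toLinearMap ∘ₗ Γ₀)
  have hΓ : ∀ u v y, g (Γ u v) y = (1 / 2 : ℝ) * (g' u v y + g' v u y - g' y u v) :=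
    fun u v y => (he _ _).trans (hℓ u v y)
  refine ⟨Γ, fun u v => sub_eq_zero.1 (hnd _ fun y => ?_), fun u x y => ?_⟩
  · rw [map_sub, sub_apply, hΓ, hΓ, hg' y u v]; ring
  · rw [hsymm x, hΓ, hΓ, hg' u y x]; ring

namespace AdaptedGerm

variable {lam : ℂ} {ε : ℝ} {c : ℂ} {y₀ : E} {g : E → E →L[ℝ] E →L[ℝ] ℝ}
    {L : E → E →L[ℝ] E} {w : E → E [⋀^Fin 2]→L[ℝ] ℝ} {P Q : E → E [⋀^Fin 4]→L[ℝ] ℂ}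

/-- This field of frames is the identity at y₀ with derivative −Γ, so the ordinary derivative at y₀
of a tensor pulled back by it is the covariant derivative of the tensor. -/
theorem hasFDerivAt_gaugeMap (Γ : E →L[ℝ] E →L[ℝ] E) :
    HasFDerivAt (fun z => .id ℝ E - Γ (z - y₀)) (-Γ) y₀ := by
  simpa only [map_sub] using
    ((Γ.hasFDerivAt (x := y₀)).sub_const (Γ y₀)).const_sub (ContinuousLinearMap.id ℝ E)

/-- The covariant derivative of a form at `y₀` in terms of the pullback by `1 - Γ (z - y₀)`. -/
theorem hasFDerivAt_gauge {k : ℕ} {F : Type*} [NormedAddCommGroup F] [NormedSpace ℝ F]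
    {η : E → E [⋀^Fin k]→L[ℝ] F} (hη : DifferentiableAt ℝ η y₀) (Γ : E →L[ℝ] E →L[ℝ] E) :
    HasFDerivAt (fun z => (η z).compContinuousLinearMap (.id ℝ E - Γ (z - y₀)))
      (fderiv ℝ η y₀ - (η y₀).fderivCompContinuousLinearMap (.id ℝ E) ∘L Γ) y₀ := by
  have hG := hasFDerivAt_gaugeMap (y₀ := y₀) Γ
  have := hη.hasFDerivAt.continuousAlternatingMapCompContinuousLinearMap hG
  simp only [sub_self, map_zero, sub_zero] at this
  refine this.congr_fderiv ?_
  ext u v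
  simp [sub_eq_add_neg]

/-- The correction term is the action of Γ on η, and its alternation vanishes because Γ is
symmetric: d can be computed with any torsion-free connection. -/
theorem extDeriv_gauge {k : ℕ} {F : Type*} [NormedAddCommGroup F] [NormedSpace ℝ F]
    {η : E → E [⋀^Fin k]→L[ℝ] F} (hη : DifferentiableAt ℝ η y₀) {Γ : E →L[ℝ] E →L[ℝ] E}
    (hΓ : ∀ u v, Γ u v = Γ v u) :
    extDeriv (fun z => (η z).compContinuousLinearMap (.id ℝ E - Γ (z - y₀))) y₀
      = extDeriv η y₀ := by
  rw [extDeriv, (hasFDerivAt_gauge hη Γ).fderiv, sub_eq_add_neg, ← neg_one_smul ℝ,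
    ContinuousAlternatingMap.alternatizeUncurryFin_add,
    ContinuousAlternatingMap.alternatizeUncurryFin_smul,
    ContinuousAlternatingMap.alternatizeUncurryFin_fderivCompContinuousLinearMap_eq_zero _ _ hΓ,
    smul_zero, add_zero]
  rfl

/-- A germ of an adapted structure with closed forms has a torsion-free connection preserving it
at `y₀`. -/
theorem exists_connection [FiniteDimensional ℝ E] (h : AdaptedGerm lam ε c y₀ g L w P Q)
    (hw : extDeriv w y₀ = 0) (hP : extDeriv P y₀ = 0) (hQ : extDeriv Q y₀ = 0) :
    ∃ Γ : E →L[ℝ] E →L[ℝ] E, (∀ u v, Γ u v = Γ v u) ∧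
      (∀ u x y, fderiv ℝ g y₀ u x y = g y₀ (Γ u x) y + g y₀ x (Γ u y)) ∧
      (∀ u x, fderiv ℝ L y₀ u x + Γ u (L y₀ x) = L y₀ (Γ u x)) ∧
      fderiv ℝ w y₀ = (w y₀).fderivCompContinuousLinearMap (.id ℝ E) ∘L Γ ∧
      fderiv ℝ P y₀ = (P y₀).fderivCompContinuousLinearMap (.id ℝ E) ∘L Γ ∧
      fderiv ℝ Q y₀ = (Q y₀).fderivCompContinuousLinearMap (.id ℝ E) ∘L Γ := by
  have : CompleteSpace E := FiniteDimensional.complete ℝ E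
  have h0 := h.adapted.self_of_nhds
  have hgd : ∀ x y : E, HasFDerivAt (fun z => g z x y) ((fderiv ℝ g y₀).flip x |>.flip y) y₀ :=
    fun x y => by
      refine ((h.diff_g.hasFDerivAt.clm_apply (hasFDerivAt_const x y₀)).clm_apply
        (hasFDerivAt_const y y₀)).congr_fderiv ?_
      ext u; simp
  obtain ⟨Γ, hΓ, hΓg⟩ := exists_leviCivita (g := g y₀) h0.nondeg h0.symm (g' := fderiv ℝ g y₀)
    fun u x y => congrArg (· u) (((hgd y x).congr_of_eventuallyEq
      (h.adapted.mono fun z hz => hz.symm x y)).unique (hgd x y)).symm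
  set G : E → E →L[ℝ] E := fun z => .id ℝ E - Γ (z - y₀) with hGdef
  have hG0 : G y₀ = .id ℝ E := by simp [hGdef]
  have hG : HasFDerivAt G (-Γ) y₀ := hasFDerivAt_gaugeMap Γ
  have hinv : ∀ᶠ z in 𝓝 y₀, ∃ e : E ≃L[ℝ] E, (e : E →L[ℝ] E) = G z := by
    have : Set.range ((↑) : (E ≃L[ℝ] E) → E →L[ℝ] E) ∈ 𝓝 (G y₀) := by
      rw [hG0]; exact (ContinuousLinearEquiv.refl ℝ E).nhds
    exact hG.continuousAt this
  have hGi : DifferentiableAt ℝ (fun z => (G z).inverse) y₀ := by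
    have := (contDiffAt_map_inverse (n := 1) (ContinuousLinearEquiv.refl ℝ E)).differentiableAt
      one_ne_zero
    rw [ContinuousLinearEquiv.coe_refl, ← hG0] at this
    exact this.comp y₀ hG.differentiableAt
  let g₁ : E → E →L[ℝ] E →L[ℝ] ℝ := fun z =>
    (ContinuousLinearMap.compL ℝ E E ℝ).flip (G z) ∘L g z ∘L G z
  let L₁ : E → E →L[ℝ] E := fun z => (G z).inverse ∘L L z ∘L G z
  have hL₁ : DifferentiableAt ℝ L₁ y₀ :=
    hGi.clm_comp (h.diff_L.clm_comp hG.differentiableAt)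
  have hg₁ : DifferentiableAt ℝ g₁ y₀ :=
    ((ContinuousLinearMap.compL ℝ E E ℝ).flip.differentiableAt.comp y₀
      hG.differentiableAt).clm_comp (h.diff_g.clm_comp hG.differentiableAt)
  -- Near y₀ the map `G z` is invertible, and the relations in `IsAdapted` are invariant under a
  -- linear isomorphism at each point.
  have germ : AdaptedGerm lam ε c y₀ g₁ L₁ (fun z => (w z).compContinuousLinearMap (G z))
      (fun z => (P z).compContinuousLinearMap (G z))
      (fun z => (Q z).compContinuousLinearMap (G z)) :=
    { sq_lam := h.sq_lam
      ne_zero := h.ne_zero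
      diff_g := hg₁
      diff_L := hL₁
      diff_w := (hasFDerivAt_gauge h.diff_w Γ).differentiableAt
      diff_P := (hasFDerivAt_gauge h.diff_P Γ).differentiableAt
      diff_Q := (hasFDerivAt_gauge h.diff_Q Γ).differentiableAt
      adapted := by
        filter_upwards [h.adapted, hinv] with z hz ⟨e, he⟩
        have := hz.comp e.toLinearEquiv
        convert this using 1
        · ext x y
          simp [g₁, ← he]
        · ext x
          simp [L₁, ← he]
        · ext v
          simp [← he, Function.comp_def]
        · ext v
          simp [← he, Function.comp_def]
        · ext v
          simp [← he, Function.comp_def] }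
  -- This is metric compatibility of Γ, read in the new frame.
  have hg₁0 : fderiv ℝ g₁ y₀ = 0 := by
    ext u x y
    have d1 := (hg₁.hasFDerivAt.clm_apply (hasFDerivAt_const x y₀)).clm_apply
      (hasFDerivAt_const y y₀)
    have d2 := (h.diff_g.hasFDerivAt.clm_apply (hG.clm_apply (hasFDerivAt_const x y₀))).clm_apply
      (hG.clm_apply (hasFDerivAt_const y y₀))
    have := congrArg (· u) (d1.unique d2)
    simp [hG0] at this
    rw [this, hΓg]
    simp
  obtain ⟨hL0, hw0, hP0, hQ0⟩ := germ.fderiv_eq_zero hg₁0 ((extDeriv_gauge h.diff_w hΓ).trans hw)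
    ((extDeriv_gauge h.diff_P hΓ).trans hP) ((extDeriv_gauge h.diff_Q hΓ).trans hQ)
  refine ⟨Γ, hΓ, hΓg, fun u x => ?_, ?_, ?_, ?_⟩
  -- To avoid differentiating the inverse, L₁ = G⁻¹ L G is used in the form G L₁ = L G. With the
  -- derivative of L₁ zero this reads −Γ L = ∂L − L Γ.
  · have d1 := hG.clm_apply (hL₁.hasFDerivAt.clm_apply (hasFDerivAt_const x y₀))
    have d2 := h.diff_L.hasFDerivAt.clm_apply (hG.clm_apply (hasFDerivAt_const x y₀))
    have := congrArg (· u) ((d1.congr_of_eventuallyEq (hinv.mono fun z ⟨e, he⟩ => by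
      simp [L₁, ← he])).unique d2)
    have hL₁0 : L₁ y₀ = L y₀ := by
      ext x; simp [L₁, hG0]
    simp [hG0, hL0, hL₁0] at this
    rw [add_comm, ← sub_eq_zero]
    linear_combination (norm := module) (-1 : ℝ) • this
  · exact sub_eq_zero.1 ((hasFDerivAt_gauge h.diff_w Γ).fderiv.symm.trans hw0)
  · exact sub_eq_zero.1 ((hasFDerivAt_gauge h.diff_P Γ).fderiv.symm.trans hP0)
  · exact sub_eq_zero.1 ((hasFDerivAt_gauge h.diff_Q Γ).fderiv.symm.trans hQ0)

end AdaptedGerm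

end Connection

/-! ### The square of a 2-form and its exterior derivative. -/

section Wedge

variable {E : Type*} [NormedAddCommGroup E] [NormedSpace ℝ E]

theorem wedge₂₂_apply (α β : E [⋀^Fin 2]→L[ℝ] ℝ) (v : Fin 4 → E) :
    wedge₂₂ α β v = α ![v 0, v 1] * β ![v 2, v 3] - α ![v 0, v 2] * β ![v 1, v 3]
      + α ![v 0, v 3] * β ![v 1, v 2] + α ![v 1, v 2] * β ![v 0, v 3]
      - α ![v 1, v 3] * β ![v 0, v 2] + α ![v 2, v 3] * β ![v 0, v 1] := rfl

theorem isBoundedBilinearMap_wedge₂₂ : IsBoundedBilinearMap ℝ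
    fun p : (E [⋀^Fin 2]→L[ℝ] ℝ) × (E [⋀^Fin 2]→L[ℝ] ℝ) => wedge₂₂ p.1 p.2 where
  add_left _ _ _ := by ext v; simp [wedge₂₂_apply]; ring
  smul_left _ _ _ := by ext v; simp [wedge₂₂_apply]; ring
  add_right _ _ _ := by ext v; simp [wedge₂₂_apply]; ring
  smul_right _ _ _ := by ext v; simp [wedge₂₂_apply]; ring
  bound := by
    -- One unit for each of the six shuffles.
    refine ⟨6, by norm_num, fun α β => ?_⟩
    refine ContinuousAlternatingMap.opNorm_le_bound _ (by positivity) fun v => ?_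
    have h : ∀ i j k l : Fin 4, ‖v i‖ * ‖v j‖ * (‖v k‖ * ‖v l‖) = ∏ i, ‖v i‖ →
        |α ![v i, v j] * β ![v k, v l]| ≤ ‖α‖ * ‖β‖ * ∏ i, ‖v i‖ := fun i j k l h => by
      have h1 := α.le_opNorm ![v i, v j]
      have h2 := β.le_opNorm ![v k, v l]
      simp only [Fin.prod_univ_two, Matrix.cons_val_zero, Matrix.cons_val_one] at h1 h2
      rw [abs_mul, ← h]
      calc |α ![v i, v j]| * |β ![v k, v l]|
          ≤ (‖α‖ * (‖v i‖ * ‖v j‖)) * (‖β‖ * (‖v k‖ * ‖v l‖)) :=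
            mul_le_mul h1 h2 (abs_nonneg _) (by positivity)
        _ = _ := by ring
    rw [wedge₂₂_apply, Real.norm_eq_abs]
    have h0 := h 0 1 2 3 (by rw [Fin.prod_univ_four]; ring)
    have h1 := h 0 2 1 3 (by rw [Fin.prod_univ_four]; ring)
    have h2 := h 0 3 1 2 (by rw [Fin.prod_univ_four]; ring)
    have h3 := h 1 2 0 3 (by rw [Fin.prod_univ_four]; ring)
    have h4 := h 1 3 0 2 (by rw [Fin.prod_univ_four]; ring)
    have h5 := h 2 3 0 1 (by rw [Fin.prod_univ_four]; ring)
    rw [abs_le] at *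
    constructor <;> linarith

theorem hasFDerivAt_wedge₂₂_self {w : E → E [⋀^Fin 2]→L[ℝ] ℝ} {y₀ : E}
    (hw : DifferentiableAt ℝ w y₀) :
    HasFDerivAt (fun z => wedge₂₂ (w z) (w z))
      (isBoundedBilinearMap_wedge₂₂.deriv (w y₀, w y₀) ∘L
        (fderiv ℝ w y₀).prod (fderiv ℝ w y₀)) y₀ :=
  HasFDerivAt.comp y₀ (f := fun z => (w z, w z))
    (g := fun p : (E [⋀^Fin 2]→L[ℝ] ℝ) × (E [⋀^Fin 2]→L[ℝ] ℝ) => wedge₂₂ p.1 p.2)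
    (isBoundedBilinearMap_wedge₂₂.hasFDerivAt (w y₀, w y₀)) (hw.hasFDerivAt.prodMk hw.hasFDerivAt)

/-- `d(ω ∧ ω) = 2 ω ∧ dω`. -/
theorem extDeriv_wedge₂₂_self {w : E → E [⋀^Fin 2]→L[ℝ] ℝ} {y₀ : E}
    (hw : DifferentiableAt ℝ w y₀) (v₀ v₁ v₂ v₃ v₄ : E) :
    extDeriv (fun z => wedge₂₂ (w z) (w z)) y₀ ![v₀, v₁, v₂, v₃, v₄]
      = 2 * wedge₂₃ (fun x y => w y₀ ![x, y]) (fun x y z => extDeriv w y₀ ![x, y, z])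
          v₀ v₁ v₂ v₃ v₄ := by
  rw [extDeriv, (hasFDerivAt_wedge₂₂_self hw).fderiv, alternatize_apply_vec₅]
  simp only [extDeriv, alternatize_apply_vec₃, wedge₂₃]
  simp [IsBoundedBilinearMap.deriv_apply, wedge₂₂_apply]
  ring

theorem apply_vec₃_swap₀₁ (χ : E [⋀^Fin 3]→L[ℝ] ℝ) (x y z : E) :
    χ ![x, y, z] = -χ ![y, x, z] := by
  have e : ![y, x, z] ∘ Equiv.swap (0 : Fin 3) 1 = ![x, y, z] := by
    ext i; fin_cases i <;> rfl
  have h : χ (![y, x, z] ∘ Equiv.swap (0 : Fin 3) 1) = -χ ![y, x, z] :=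
    χ.toAlternatingMap.map_swap ![y, x, z] (i := 0) (j := 1) (by decide)
  rwa [e] at h

theorem apply_vec₃_swap₁₂ (χ : E [⋀^Fin 3]→L[ℝ] ℝ) (x y z : E) :
    χ ![x, y, z] = -χ ![x, z, y] := by
  have e : ![x, z, y] ∘ Equiv.swap (1 : Fin 3) 2 = ![x, y, z] := by
    ext i; fin_cases i <;> rfl
  have h : χ (![x, z, y] ∘ Equiv.swap (1 : Fin 3) 2) = -χ ![x, z, y] :=
    χ.toAlternatingMap.map_swap ![x, z, y] (i := 1) (j := 2) (by decide)
  rwa [e] at h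

/-- If `ω` is a nondegenerate 2-form in dimension 8 and `ω ∧ ω` is closed, then so is `ω`. -/
theorem extDeriv_eq_zero_of_extDeriv_wedge₂₂_self [FiniteDimensional ℝ E]
    (hdim : Module.finrank ℝ E = 8) {w : E → E [⋀^Fin 2]→L[ℝ] ℝ} {y₀ : E}
    (hw : DifferentiableAt ℝ w y₀) (hnd : ∀ x, (∀ y, w y₀ ![x, y] = 0) → x = 0)
    (h : extDeriv (fun z => wedge₂₂ (w z) (w z)) y₀ = 0) : extDeriv w y₀ = 0 := by
  let B : LinearMap.BilinForm ℝ E := LinearMap.mk₂ ℝ (fun x y => w y₀ ![x, y])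
    (fun x x' y => by simpa using (w y₀).vecCons_add ![y] x x')
    (fun c x y => by simpa using (w y₀).vecCons_smul ![y] c x)
    (fun x y y' => by
      have := (w y₀).map_update_add ![x, y] 1 y y'
      simpa only [update_vec₂_one] using this)
    (fun c x y => by
      have := (w y₀).map_update_smul ![x, y] 1 c y
      simpa only [update_vec₂_one] using this)
  have hBapp : ∀ x y, B x y = w y₀ ![x, y] := fun _ _ => rfl
  have hskew : ∀ x y, B x y = -B y x := fun x y => apply_vec₂_swap _ _ _
  have hB : B.Nondegenerate :=
    ⟨hnd, fun y hy => hnd y fun x => by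
      have := hskew y x
      rwa [hy, neg_zero] at this⟩
  let b : Module.Basis (Fin 8) ℝ E := Module.finBasisOfFinrankEq ℝ E hdim
  let f := B.dualBasis hB b
  have hfb : ∀ i j, B (f i) (b j) = if j = i then 1 else 0 := fun i j =>
    B.apply_dualBasis_left hB b i j
  have hb : ∀ x, ∑ a, B (f a) x • b a = x := fun x => by
    conv_rhs => rw [← b.sum_repr x]
    refine Finset.sum_congr rfl fun a _ => ?_
    congr 1
    have := congrArg (B (f a)) (b.sum_repr x)
    rw [← this]
    simp only [_root_.map_sum, map_smul, hfb]
    simp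
  have hf : ∀ x, ∑ a, B (b a) x • f a = -x := fun x => by
    rw [← f.sum_repr x, ← Finset.sum_neg_distrib]
    refine Finset.sum_congr rfl fun a _ => ?_
    rw [← neg_smul]
    congr 1
    rw [f.sum_repr x, hskew]
    exact congrArg Neg.neg (B.dualBasis_repr_apply hB b x a).symm
  ext x
  have ex : x = ![x 0, x 1, x 2] := by ext i; fin_cases i <;> rfl
  rw [ex]
  -- A basis and its dual basis for w serve as the two frames; the trace is 8 because w pairs each
  -- dual vector to 1 with its partner.
  refine eq_zero_of_wedge₂₃_eq_zero (w := fun x y => w y₀ ![x, y])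
    (χ := fun x y z => extDeriv w y₀ ![x, y, z]) (fun y z => ⟨fun _ _ => ?_, fun _ _ => ?_⟩)
    (apply_vec₃_swap₀₁ _) (apply_vec₃_swap₁₂ _) (e := f) (f := b) hb hf ?_ ?_ _ _ _
  · simpa using (extDeriv w y₀).vecCons_add ![y, z] _ _
  · simpa using (extDeriv w y₀).vecCons_smul ![y, z] _ _
  · simp [← hBapp, hfb]
  · intro v₀ v₁ v₂ v₃ v₄
    have := extDeriv_wedge₂₂_self hw v₀ v₁ v₂ v₃ v₄
    rw [h] at this
    simpa using this.symm

end Wedge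

/-! ## Vector fields in a chart -/

section Charts

/-- The model space. -/
abbrev Model : Type := EuclideanSpace ℝ (Fin 8)

variable {M : Type*} [TopologicalSpace M] [ChartedSpace (EuclideanSpace ℝ (Fin 8)) M]

/-- The derivative of the preferred chart at `x` at the point `y`. -/
def chartMap (x y : M) : TangentSpace (𝓡 8) y →L[ℝ] Model :=
  mfderiv (𝓡 8) 𝓘(ℝ, Model) (extChartAt (𝓡 8) x) y

/-- The derivative of the inverse of the preferred chart at `x`. -/
def chartInv (x : M) (z : Model) : Model →L[ℝ] TangentSpace (𝓡 8) ((extChartAt (𝓡 8) x).symm z) :=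
  mfderiv 𝓘(ℝ, Model) (𝓡 8) (extChartAt (𝓡 8) x).symm z

/-- The components of a vector field in the preferred chart at `x`. -/
def rep (x : M) (Y : ∀ y : M, TangentSpace (𝓡 8) y) (z : Model) : Model :=
  chartMap x ((extChartAt (𝓡 8) x).symm z) (Y ((extChartAt (𝓡 8) x).symm z))

variable [IsManifold (𝓡 8) ∞ M] {x : M} {z : Model}

theorem chartMap_chartInv (hz : z ∈ (extChartAt (𝓡 8) x).target) (u : Model) :
    chartMap x _ (chartInv x z u) = u := by
  have h := mfderiv_extChartAt_comp_mfderivWithin_extChartAt_symm (I := 𝓡 8) hz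
  rw [ModelWithCorners.range_eq_univ, mfderivWithin_univ] at h
  exact DFunLike.congr_fun h u

theorem chartInv_chartMap (hz : z ∈ (extChartAt (𝓡 8) x).target)
    (u : TangentSpace (𝓡 8) ((extChartAt (𝓡 8) x).symm z)) :
    chartInv x z (chartMap x _ u) = u := by
  have h := mfderivWithin_extChartAt_symm_comp_mfderiv_extChartAt (I := 𝓡 8) hz
  rw [ModelWithCorners.range_eq_univ, mfderivWithin_univ] at h
  exact DFunLike.congr_fun h u

/-- The derivative of the inverse of a chart, as a linear isomorphism. -/
def chartEquiv (hz : z ∈ (extChartAt (𝓡 8) x).target) :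
    Model ≃ₗ[ℝ] TangentSpace (𝓡 8) ((extChartAt (𝓡 8) x).symm z) :=
  { (chartInv x z : Model →ₗ[ℝ] TangentSpace (𝓡 8) ((extChartAt (𝓡 8) x).symm z)) with
    invFun := chartMap x _
    left_inv := chartMap_chartInv hz
    right_inv := chartInv_chartMap hz }

theorem chartInv_rep (hz : z ∈ (extChartAt (𝓡 8) x).target) (Y : ∀ y : M, TangentSpace (𝓡 8) y) :
    chartInv x z (rep x Y z) = Y _ := chartInv_chartMap hz _

omit [IsManifold (𝓡 8) ∞ M] in
theorem rep_extChartAt {y : M} (hy : y ∈ (extChartAt (𝓡 8) x).source)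
    (Y : ∀ y : M, TangentSpace (𝓡 8) y) :
    rep x Y (extChartAt (𝓡 8) x y) = chartMap x y (Y y) := by
  have h := (extChartAt (𝓡 8) x).left_inv hy
  exact congrArg (fun p => chartMap x p (Y p)) h

theorem exists_coe_eq_chartMap {y : M} (hy : y ∈ (extChartAt (𝓡 8) x).source) :
    ∃ e : TangentSpace (𝓡 8) y ≃L[ℝ] Model,
      (e : TangentSpace (𝓡 8) y →L[ℝ] Model) = chartMap x y :=
  isInvertible_mfderiv_extChartAt (I := 𝓡 8) hy

variable (x) in
/-- The identification of the tangent space at `x` with the model space. -/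
def tangentEquiv : TangentSpace (𝓡 8) x ≃L[ℝ] Model :=
  (exists_coe_eq_chartMap (mem_extChartAt_source x)).choose

theorem tangentEquiv_apply (v : TangentSpace (𝓡 8) x) : tangentEquiv x v = chartMap x x v :=
  DFunLike.congr_fun (exists_coe_eq_chartMap (mem_extChartAt_source x)).choose_spec v

theorem rep_self (Y : ∀ y : M, TangentSpace (𝓡 8) y) :
    rep x Y (extChartAt (𝓡 8) x x) = tangentEquiv x (Y x) := by
  rw [rep_extChartAt (mem_extChartAt_source x), tangentEquiv_apply]

theorem mdifferentiableAt_iff_comp_symm {F : Type*} [NormedAddCommGroup F] [NormedSpace ℝ F]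
    {f : M → F} : MDifferentiableAt (𝓡 8) 𝓘(ℝ, F) f x ↔
      DifferentiableAt ℝ (f ∘ (extChartAt (𝓡 8) x).symm) (extChartAt (𝓡 8) x x) := by
  refine ⟨fun h => ?_, fun h => ?_⟩
  · have := (mdifferentiableAt_iff _ _ |>.1 h).2
    rw [ModelWithCorners.range_eq_univ, differentiableWithinAt_univ] at this
    exact this
  · have h2 : MDifferentiableAt (𝓡 8) 𝓘(ℝ, Model) (extChartAt (𝓡 8) x) x :=
      mdifferentiableAt_extChartAt (mem_chart_source _ x)
    refine (h.mdifferentiableAt.comp x h2).congr_of_eventuallyEq ?_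
    filter_upwards [extChartAt_source_mem_nhds (I := 𝓡 8) x] with y hy
    simp only [comp_apply, (extChartAt (𝓡 8) x).left_inv hy]

/-- Over the chart domain the trivialization of the tangent bundle at x is the derivative of the
chart, so differentiability of a section is that of its components. -/
theorem diffAt_iff (Y : ∀ y : M, TangentSpace (𝓡 8) y) :
    DiffAt Y x ↔ DifferentiableAt ℝ (rep x Y) (extChartAt (𝓡 8) x x) := by
  have h1 : DiffAt Y x ↔ MDifferentiableAt (𝓡 8) 𝓘(ℝ, Model) (fun y => chartMap x y (Y y)) x := by
    refine (mdifferentiableAt_section (𝓡 8) Y).trans ?_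
    refine Filter.EventuallyEq.mdifferentiableAt_iff ?_
    filter_upwards [chart_source_mem_nhds (EuclideanSpace ℝ (Fin 8)) x] with y hy
    have := TangentBundle.continuousLinearMapAt_trivializationAt (I := 𝓡 8) hy
    have h2 := DFunLike.congr_fun this (Y y)
    rw [Bundle.Trivialization.continuousLinearMapAt_apply,
      Bundle.Trivialization.linearMapAt_apply, if_pos (by simpa using hy)] at h2
    exact h2
  exact h1.trans mdifferentiableAt_iff_comp_symm

theorem mvfderiv_eq {F : Type*} [NormedAddCommGroup F] [NormedSpace ℝ F] {f : M → F}
    {D : Model →L[ℝ] F}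
    (h : HasFDerivAt (f ∘ (extChartAt (𝓡 8) x).symm) D (extChartAt (𝓡 8) x x))
    (v : TangentSpace (𝓡 8) x) : mvfderiv (𝓡 8) f x v = D (tangentEquiv x v) := by
  have h1 : HasMFDerivAt 𝓘(ℝ, Model) 𝓘(ℝ, F) (f ∘ (extChartAt (𝓡 8) x).symm) (extChartAt (𝓡 8) x x) D := h.hasMFDerivAt
  have h2 : HasMFDerivAt (𝓡 8) 𝓘(ℝ, Model) (extChartAt (𝓡 8) x) x (chartMap x x) :=
    (mdifferentiableAt_extChartAt (mem_chart_source _ x)).hasMFDerivAt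
  have h3 := h1.comp x h2
  have h4 : f =ᶠ[𝓝 x] (f ∘ (extChartAt (𝓡 8) x).symm) ∘ extChartAt (𝓡 8) x := by
    filter_upwards [extChartAt_source_mem_nhds (I := 𝓡 8) x] with y hy
    simp only [comp_apply, (extChartAt (𝓡 8) x).left_inv hy]
  have h5 := (h3.congr_of_eventuallyEq h4).mfderiv
  rw [tangentEquiv_apply]
  unfold mvfderiv
  rw [ContinuousLinearMap.comp_apply, h5]
  rfl

/-- The vector field with constant components `a` in the preferred chart at `x`. -/
def constField (x : M) (a : Model) (y : M) : TangentSpace (𝓡 8) y := (chartMap x y).inverse a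

theorem rep_constField (a : Model) (hz : z ∈ (extChartAt (𝓡 8) x).target) :
    rep x (constField x a) z = a := by
  obtain ⟨e, he⟩ := exists_coe_eq_chartMap ((extChartAt (𝓡 8) x).map_target hz)
  rw [rep, constField, ← he, ContinuousLinearMap.inverse_equiv]
  exact e.apply_symm_apply a

omit [IsManifold (𝓡 8) ∞ M] in
theorem eventually_mem_target : ∀ᶠ z in 𝓝 (extChartAt (𝓡 8) x x),
    z ∈ (extChartAt (𝓡 8) x).target := extChartAt_target_mem_nhds x

theorem rep_constField_eventuallyEq (a : Model) :
    rep x (constField x a) =ᶠ[𝓝 (extChartAt (𝓡 8) x x)] fun _ => a :=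
  eventually_mem_target.mono fun _ hz => rep_constField a hz

theorem diffAt_constField (a : Model) : DiffAt (constField x a) x :=
  (diffAt_iff _).2 ((differentiableAt_const a).congr_of_eventuallyEq
    (rep_constField_eventuallyEq a))

theorem fderiv_rep_constField (a : Model) :
    fderiv ℝ (rep x (constField x a)) (extChartAt (𝓡 8) x x) = 0 := by
  rw [(rep_constField_eventuallyEq a).fderiv_eq]; simp

theorem tangentEquiv_constField (a : Model) : tangentEquiv x (constField x a x) = a := by
  rw [← rep_self, rep_constField a (mem_extChartAt_target x)]

theorem constField_self (v : TangentSpace (𝓡 8) x) :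
    constField x (tangentEquiv x v) x = v :=
  (tangentEquiv x).injective (tangentEquiv_constField _)

omit [IsManifold (𝓡 8) ∞ M] in
theorem rep_add (Y Z : ∀ y : M, TangentSpace (𝓡 8) y) : rep x (Y + Z) = rep x Y + rep x Z := by
  ext1 z; exact map_add (chartMap x _) _ _

omit [IsManifold (𝓡 8) ∞ M] in
theorem rep_smul (f : M → ℝ) (Y : ∀ y : M, TangentSpace (𝓡 8) y) :
    rep x (f • Y) = fun z => f ((extChartAt (𝓡 8) x).symm z) • rep x Y z := by
  ext1 z; exact map_smul (chartMap x _) _ _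

/-- The bracket is defined by pulling back through the inverse chart, and near the base point the
pulled-back fields are the component functions. -/
theorem tangentEquiv_mlieBracket (Y Z : ∀ y : M, TangentSpace (𝓡 8) y) :
    tangentEquiv x (VectorField.mlieBracket (𝓡 8) Y Z x)
      = fderiv ℝ (rep x Z) (extChartAt (𝓡 8) x x) (tangentEquiv x (Y x))
        - fderiv ℝ (rep x Y) (extChartAt (𝓡 8) x x) (tangentEquiv x (Z x)) := by
  have key : ∀ X : ∀ y : M, TangentSpace (𝓡 8) y,
      VectorField.mpullbackWithin 𝓘(ℝ, Model) (𝓡 8) (extChartAt (𝓡 8) x).symm X (Set.range (𝓡 8))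
        =ᶠ[𝓝 (extChartAt (𝓡 8) x x)] rep x X := fun X => by
    filter_upwards [eventually_mem_target] with z hz
    rw [VectorField.mpullbackWithin_apply, ModelWithCorners.range_eq_univ, mfderivWithin_univ]
    obtain ⟨e, he⟩ := isInvertible_mfderivWithin_extChartAt_symm (I := 𝓡 8) hz
    rw [ModelWithCorners.range_eq_univ, mfderivWithin_univ] at he
    rw [← he, ContinuousLinearMap.inverse_equiv]
    apply e.injective
    refine (e.apply_symm_apply _).trans ?_
    refine Eq.trans ?_ (DFunLike.congr_fun he.symm _)
    exact (chartInv_rep hz X).symm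
  rw [← VectorField.mlieBracketWithin_univ, VectorField.mlieBracketWithin_apply]
  obtain ⟨e, he⟩ := isInvertible_mfderiv_extChartAt (I := 𝓡 8) (mem_extChartAt_source x)
  rw [← he, ContinuousLinearMap.inverse_equiv, tangentEquiv_apply]
  refine (DFunLike.congr_fun he.symm _).trans ((e.apply_symm_apply _).trans ?_)
  rw [← rep_self, ← rep_self]
  have aux : ∀ {V W V' W' : Model → Model} {p : Model} {s : Set Model}, V =ᶠ[𝓝 p] V' →
      W =ᶠ[𝓝 p] W' → s = Set.univ → VectorField.lieBracketWithin ℝ V W s p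
        = fderiv ℝ W' p (V' p) - fderiv ℝ V' p (W' p) := fun hV hW hs => by
    rw [hs, VectorField.lieBracketWithin_univ, hV.lieBracket_vectorField_eq hW,
      VectorField.lieBracket_eq]
  exact aux (key Y) (key Z) (by simp)

end Charts

/-! ## Connections in a chart -/

section Connections

variable {M : Type*} [TopologicalSpace M] [ChartedSpace (EuclideanSpace ℝ (Fin 8)) M]
  [IsManifold (𝓡 8) ∞ M] {x : M}

variable (M) in
/-- The connection which is flat to first order in the preferred chart at each point. -/
def flatConnection : AffineConnection M where
  -- The chart used varies with x without any continuity; additivity and the Leibniz rule are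
  -- conditions at each single point, so this is still a covariant derivative.
  toFun Y x := ((tangentEquiv x).symm : Model →L[ℝ] TangentSpace (𝓡 8) x) ∘L
    fderiv ℝ (rep x Y) (extChartAt (𝓡 8) x x) ∘L (tangentEquiv x : TangentSpace (𝓡 8) x →L[ℝ] Model)
  isCovariantDerivativeOnUniv := by
    refine ⟨fun {Y Z x} hY hZ _ => ?_, fun {Y f x} hY hf _ => ?_⟩
    · ext1 v
      have := fderiv_add ((diffAt_iff Y).1 hY) ((diffAt_iff Z).1 hZ)
      rw [rep_add, this]
      exact map_add (tangentEquiv x).symm _ _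
    · ext1 v
      have hf' := mdifferentiableAt_iff_comp_symm.1 hf
      have := fderiv_smul hf' ((diffAt_iff Y).1 hY)
      rw [rep_smul]
      have h3 := mvfderiv_eq hf'.hasFDerivAt v
      have h4 : rep x Y (extChartAt (𝓡 8) x x) = _ := rep_self Y
      have h5 : (f ∘ (extChartAt (𝓡 8) x).symm) (extChartAt (𝓡 8) x x) = f x := by simp
      rw [h4, h5] at this
      apply (tangentEquiv x).injective
      have e1 : ∀ (A : Model →L[ℝ] Model) (w : TangentSpace (𝓡 8) x), tangentEquiv x
          ((((tangentEquiv x).symm : Model →L[ℝ] TangentSpace (𝓡 8) x) ∘L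
            A ∘L (tangentEquiv x : TangentSpace (𝓡 8) x →L[ℝ] Model)) w) = A (tangentEquiv x w) :=
        fun A w => (tangentEquiv x).apply_symm_apply _
      refine (e1 _ v).trans ((DFunLike.congr_fun this _).trans ?_)
      refine Eq.trans ?_ (map_add (tangentEquiv x) _ _).symm
      refine congrArg₂ (fun a b : Model => a + b) ?_ ?_
      · refine Eq.trans ?_ (map_smul (tangentEquiv x) _ _).symm
        exact congrArg (f x • ·) (e1 _ v).symm
      · refine Eq.trans ?_ (map_smul (tangentEquiv x) _ _).symm
        exact congrArg (· • tangentEquiv x (Y x)) h3.symm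

theorem tangentEquiv_flatConnection (Y : ∀ y : M, TangentSpace (𝓡 8) y)
    (v : TangentSpace (𝓡 8) x) : tangentEquiv x (flatConnection M Y x v)
      = fderiv ℝ (rep x Y) (extChartAt (𝓡 8) x x) (tangentEquiv x v) :=
  (tangentEquiv x).apply_symm_apply _

/-- `Γ x` is the Christoffel symbol of the connection at `x` in the preferred chart at `x`. -/
def HasChristoffel (cov : AffineConnection M) (Γ : M → Model →L[ℝ] Model →L[ℝ] Model) : Prop :=
  ∀ (x : M) (Y : ∀ y : M, TangentSpace (𝓡 8) y), DiffAt Y x → ∀ v : TangentSpace (𝓡 8) x,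
    tangentEquiv x (cov Y x v)
      = fderiv ℝ (rep x Y) (extChartAt (𝓡 8) x x) (tangentEquiv x v)
        + Γ x (tangentEquiv x v) (tangentEquiv x (Y x))

/-- The difference of two connections is tensorial; Γ is the difference from `flatConnection`. -/
theorem exists_hasChristoffel (cov : AffineConnection M) : ∃ Γ, HasChristoffel cov Γ := by
  let B : ∀ x : M, TangentSpace (𝓡 8) x →L[ℝ] TangentSpace (𝓡 8) x →L[ℝ] TangentSpace (𝓡 8) x :=
    IsCovariantDerivativeOn.difference cov.isCovariantDerivativeOnUniv
      (flatConnection M).isCovariantDerivativeOnUniv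
  have hB : ∀ (x : M) (Y : ∀ y : M, TangentSpace (𝓡 8) y), DiffAt Y x →
      B x (Y x) = cov Y x - flatConnection M Y x := fun x Y hY =>
    IsCovariantDerivativeOn.difference_apply _ _ (Set.mem_univ x) hY
  let C : ∀ x : M, Model →ₗ[ℝ] Model →ₗ[ℝ] Model := fun x =>
    LinearMap.mk₂ ℝ (fun u a => tangentEquiv x (B x ((tangentEquiv x).symm a)
      ((tangentEquiv x).symm u)))
      (by intros; simp) (by intros; simp) (by intros; simp) (by intros; simp)
  refine ⟨fun x => LinearMap.toContinuousLinearMap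
    ((LinearMap.toContinuousLinearMap : (Model →ₗ[ℝ] Model) ≃ₗ[ℝ] _).toLinearMap ∘ₗ C x),
    fun x Y hY v => ?_⟩
  have h := DFunLike.congr_fun (hB x Y hY) v
  rw [← tangentEquiv_flatConnection]
  have e : (LinearMap.toContinuousLinearMap
    ((LinearMap.toContinuousLinearMap : (Model →ₗ[ℝ] Model) ≃ₗ[ℝ] _).toLinearMap ∘ₗ C x))
      (tangentEquiv x v) (tangentEquiv x (Y x)) = tangentEquiv x (B x (Y x) v) := by
    simp [C]
  rw [e, h, ← map_add]
  simp

/-- No regularity of Γ in x is required, which allows the symbols to be chosen independently at each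
point. -/
theorem exists_connection_hasChristoffel (Γ : M → Model →L[ℝ] Model →L[ℝ] Model) :
    ∃ cov : AffineConnection M, HasChristoffel cov Γ := by
  let A : ∀ x : M, TangentSpace (𝓡 8) x →L[ℝ] TangentSpace (𝓡 8) x →L[ℝ] TangentSpace (𝓡 8) x :=
    fun x => (ContinuousLinearMap.postcomp (TangentSpace (𝓡 8) x)
        ((tangentEquiv x).symm : Model →L[ℝ] TangentSpace (𝓡 8) x)) ∘L
      (ContinuousLinearMap.precomp Model (tangentEquiv x : TangentSpace (𝓡 8) x →L[ℝ] Model)) ∘L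
      (Γ x).flip ∘L (tangentEquiv x : TangentSpace (𝓡 8) x →L[ℝ] Model)
  refine ⟨(flatConnection M).addOneForm A, fun x Y hY v => ?_⟩
  have e : ((flatConnection M).addOneForm A) Y x v
    = flatConnection M Y x v + A x (Y x) v := rfl
  have e' : A x (Y x) v = (tangentEquiv x).symm (Γ x (tangentEquiv x v) (tangentEquiv x (Y x))) :=
    rfl
  rw [e, e', map_add, tangentEquiv_flatConnection, ContinuousLinearEquiv.apply_symm_apply]

/-- The derivatives of the components in the torsion cancel against the bracket, leaving the
antisymmetric part of Γ; fields with constant components realise all pairs of vectors. -/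
theorem HasChristoffel.torsion_eq_zero_iff {cov : AffineConnection M}
    {Γ : M → Model →L[ℝ] Model →L[ℝ] Model} (h : HasChristoffel cov Γ) :
    cov.torsion = 0 ↔ ∀ x u v, Γ x u v = Γ x v u := by
  rw [CovariantDerivative.torsion_eq_zero_iff]
  refine ⟨fun ht x u v => ?_, fun hΓ Y Z x hY hZ => ?_⟩
  · have := ht (diffAt_constField (x := x) u) (diffAt_constField (x := x) v)
    have := congrArg (tangentEquiv x) this
    rw [map_sub, tangentEquiv_mlieBracket, h x _ (diffAt_constField v),
      h x _ (diffAt_constField u)] at this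
    simp only [fderiv_rep_constField, tangentEquiv_constField, zero_apply,
      zero_add, sub_zero] at this
    exact sub_eq_zero.1 this
  · apply (tangentEquiv x).injective
    rw [map_sub, tangentEquiv_mlieBracket, h x _ hY, h x _ hZ, hΓ x (tangentEquiv x (Y x))]
    abel

end Connections

/-! ## Differential forms in a chart -/

section FormsInChart

variable {M : Type*} [TopologicalSpace M] [ChartedSpace (EuclideanSpace ℝ (Fin 8)) M]
  [IsManifold (𝓡 8) ∞ M] {x : M} {k : ℕ} {F : Type*} [NormedAddCommGroup F] [NormedSpace ℝ F]
  {η : Form M k F}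

theorem inChart_chartMap (η : Form M k F) {y : M} (hy : y ∈ (extChartAt (𝓡 8) x).source)
    (v : Fin k → TangentSpace (𝓡 8) y) :
    η.inChart x (extChartAt (𝓡 8) x y) (fun i => chartMap x y (v i)) = η y v := by
  obtain ⟨z, hz, rfl⟩ : ∃ z ∈ (extChartAt (𝓡 8) x).target, (extChartAt (𝓡 8) x).symm z = y :=
    ⟨_, (extChartAt (𝓡 8) x).map_source hy, (extChartAt (𝓡 8) x).left_inv hy⟩
  rw [(extChartAt (𝓡 8) x).right_inv hz]
  exact congrArg (η ((extChartAt (𝓡 8) x).symm z)) (funext fun i => chartInv_chartMap hz (v i))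

theorem inChart_self (η : Form M k F) (v : Fin k → TangentSpace (𝓡 8) x) :
    η.inChart x (extChartAt (𝓡 8) x x) (fun i => tangentEquiv x (v i)) = η x v := by
  simp only [tangentEquiv_apply]
  exact inChart_chartMap η (mem_extChartAt_source x) v

theorem inChart_rep {z : Model} (hz : z ∈ (extChartAt (𝓡 8) x).target) (η : Form M k F)
    (Y : Fin k → ∀ y : M, TangentSpace (𝓡 8) y) :
    η.inChart x z (fun i => rep x (Y i) z)
      = η ((extChartAt (𝓡 8) x).symm z) fun i => Y i ((extChartAt (𝓡 8) x).symm z) :=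
  congrArg (η ((extChartAt (𝓡 8) x).symm z)) (funext fun i => chartInv_rep hz (Y i))

theorem d_apply_eq_zero_iff :
    η.d x = 0 ↔ extDeriv (η.inChart x) (extChartAt (𝓡 8) x x) = 0 := by
  have e : ∀ v : Fin (k + 1) → TangentSpace (𝓡 8) x, η.d x v
      = extDeriv (η.inChart x) (extChartAt (𝓡 8) x x) fun i => tangentEquiv x (v i) := fun v => by
    simp only [tangentEquiv_apply]
    rfl
  refine ⟨fun h => ?_, fun h => ?_⟩
  · ext v
    have := e fun i => (tangentEquiv x).symm (v i)
    rw [h] at this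
    simpa using this.symm
  · ext v
    rw [e, h]; rfl

omit [IsManifold (𝓡 8) ∞ M] in
theorem differentiableAt_inChart (hη : η.IsSmooth) :
    DifferentiableAt ℝ (η.inChart x) (extChartAt (𝓡 8) x x) :=
  ((hη x).contDiffAt (extChartAt_target_mem_nhds x)).differentiableAt (by simp)

/-- By the product rule the derivatives of the Yᵢ occur identically on both sides of the parallel
condition and cancel. What remains is algebraic at each point and is tested on fields with constant
components. -/
theorem isParallel_iff (hη : η.IsSmooth) {cov : AffineConnection M}
    {Γ : M → Model →L[ℝ] Model →L[ℝ] Model} (h : HasChristoffel cov Γ) :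
    η.IsParallel cov ↔ ∀ x, fderiv ℝ (η.inChart x) (extChartAt (𝓡 8) x x)
      = (η.inChart x (extChartAt (𝓡 8) x x)).fderivCompContinuousLinearMap (.id ℝ Model) ∘L Γ x := by
  have key : ∀ (x : M) (Y : Fin k → ∀ y : M, TangentSpace (𝓡 8) y), (∀ i, DiffAt (Y i) x) →
      ∀ v : TangentSpace (𝓡 8) x, (mvfderiv (𝓡 8) (fun y => η y (fun i => Y i y)) x v
        - ∑ i, η x (Function.update (fun j => Y j x) i (cov (Y i) x v)))
      = fderiv ℝ (η.inChart x) (extChartAt (𝓡 8) x x) (tangentEquiv x v)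
            (fun i => tangentEquiv x (Y i x))
        - ∑ i, η.inChart x (extChartAt (𝓡 8) x x) (update (fun i => tangentEquiv x (Y i x)) i
            (Γ x (tangentEquiv x v) (tangentEquiv x (Y i x)))) := fun x Y hY v => by
    obtain ⟨D, hD, hDu⟩ := exists_hasFDerivAt_form_apply
      (differentiableAt_inChart (x := x) hη).hasFDerivAt
      (fun i => ((diffAt_iff (Y i)).1 (hY i)).hasFDerivAt)
    have hD' : HasFDerivAt ((fun y => η y (fun i => Y i y)) ∘ (extChartAt (𝓡 8) x).symm) D
        (extChartAt (𝓡 8) x x) :=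
      hD.congr_of_eventuallyEq (eventually_mem_target.mono fun z hz => (inChart_rep hz η Y).symm)
    have e : ∀ (i : Fin k) (w : TangentSpace (𝓡 8) x),
        η x (Function.update (fun j => Y j x) i w)
          = η.inChart x (extChartAt (𝓡 8) x x)
            (update (fun i => tangentEquiv x (Y i x)) i (tangentEquiv x w)) := fun i w => by
      rw [← inChart_self]
      congr 1; ext1 j
      rcases eq_or_ne j i with rfl | hij
      · simp
      · simp [hij]
    rw [mvfderiv_eq hD', hDu]
    simp only [e, h x _ (hY _), rep_self, ContinuousAlternatingMap.map_update_add,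
      Finset.sum_add_distrib]
    abel
  refine ⟨fun hp x => ?_, fun hΓ x Y hY v => ?_⟩
  · ext u a
    have := key x (fun i => constField x (a i)) (fun i => diffAt_constField _)
      ((tangentEquiv x).symm u)
    rw [hp x _ (fun i => diffAt_constField _), sub_self] at this
    simp only [ContinuousLinearEquiv.apply_symm_apply, tangentEquiv_constField] at this
    rw [← sub_eq_zero, ContinuousLinearMap.comp_apply,
      ContinuousAlternatingMap.fderivCompContinuousLinearMap_apply, this]
    congr 1
    refine Finset.sum_congr rfl fun i _ => congrArg _ (funext fun j => ?_)
    rcases eq_or_ne j i with rfl | hij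
    · simp
    · simp [hij]
  · rw [← sub_eq_zero, key x Y hY v, hΓ x, sub_eq_zero, ContinuousLinearMap.comp_apply,
      ContinuousAlternatingMap.fderivCompContinuousLinearMap_apply]
    refine Finset.sum_congr rfl fun i _ => congrArg _ (funext fun j => ?_)
    rcases eq_or_ne j i with rfl | hij
    · simp
    · simp [hij]

/-- Parallel forms of a torsion-free connection are closed. -/
theorem d_eq_zero_of_isParallel (hη : η.IsSmooth) {cov : AffineConnection M}
    (ht : cov.torsion = 0) (hp : η.IsParallel cov) : η.d = 0 := by
  obtain ⟨Γ, hΓ⟩ := exists_hasChristoffel cov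
  funext x
  refine d_apply_eq_zero_iff.2 ?_
  rw [extDeriv, (isParallel_iff hη hΓ).1 hp x]
  exact ContinuousAlternatingMap.alternatizeUncurryFin_fderivCompContinuousLinearMap_eq_zero _ _
    (hΓ.torsion_eq_zero_iff.1 ht x)

end FormsInChart

/-- A family of linear maps on a finite-dimensional space is differentiable if its values are. -/
theorem differentiableAt_clm_of_apply {E F G : Type*} [NormedAddCommGroup E] [NormedSpace ℝ E]
    [NormedAddCommGroup F] [NormedSpace ℝ F] [FiniteDimensional ℝ F] [NormedAddCommGroup G]
    [NormedSpace ℝ G] {f : E → F →L[ℝ] G} {p : E}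
    (h : ∀ a, DifferentiableAt ℝ (fun z => f z a) p) : DifferentiableAt ℝ f p := by
  let b := Module.finBasis ℝ F
  have e : f = fun z => ∑ i, (ContinuousLinearMap.smulRightL ℝ F G
      (LinearMap.toContinuousLinearMap (b.coord i))) (f z (b i)) := by
    ext z a
    conv_lhs => rw [← b.sum_repr a, map_sum]
    simp
  rw [e]
  exact DifferentiableAt.fun_sum fun i _ =>
    (ContinuousLinearMap.differentiableAt _).comp p (h (b i))

/-! ## Metrics and endomorphism fields in a chart -/

section TensorsInChart

variable {M : Type*} [TopologicalSpace M] [ChartedSpace (EuclideanSpace ℝ (Fin 8)) M]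

/-- The expression of a field of bilinear forms in the preferred chart at `x`. -/
def BilinField.inChart (g : BilinField M) (x : M) (z : Model) : Model →L[ℝ] Model →L[ℝ] ℝ :=
  ContinuousLinearMap.precomp ℝ (chartInv x z) ∘L g ((extChartAt (𝓡 8) x).symm z) ∘L chartInv x z

/-- The expression of a field of endomorphisms in the preferred chart at `x`. -/
def EndoField.inChart (K : EndoField M) (x : M) (z : Model) : Model →L[ℝ] Model :=
  chartMap x _ ∘L K ((extChartAt (𝓡 8) x).symm z) ∘L chartInv x z

theorem BilinField.inChart_apply (g : BilinField M) (x : M) (z a b : Model) :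
    g.inChart x z a b = g ((extChartAt (𝓡 8) x).symm z) (chartInv x z a) (chartInv x z b) := rfl

theorem EndoField.inChart_apply (K : EndoField M) (x : M) (z a : Model) :
    K.inChart x z a = chartMap x _ (K ((extChartAt (𝓡 8) x).symm z) (chartInv x z a)) := rfl

variable [IsManifold (𝓡 8) ∞ M] {x : M} {z : Model}

theorem BilinField.inChart_rep (g : BilinField M) (hz : z ∈ (extChartAt (𝓡 8) x).target)
    (Y Z : ∀ y : M, TangentSpace (𝓡 8) y) : g.inChart x z (rep x Y z) (rep x Z z)
      = g ((extChartAt (𝓡 8) x).symm z) (Y _) (Z _) := by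
  rw [BilinField.inChart_apply, chartInv_rep hz, chartInv_rep hz]

theorem EndoField.inChart_rep (K : EndoField M) (hz : z ∈ (extChartAt (𝓡 8) x).target)
    (Y : ∀ y : M, TangentSpace (𝓡 8) y) :
    K.inChart x z (rep x Y z) = rep x (fun y => K y (Y y)) z := by
  rw [EndoField.inChart_apply, chartInv_rep hz]; rfl

theorem EndoField.inChart_self (K : EndoField M) (v : TangentSpace (𝓡 8) x) :
    K.inChart x (extChartAt (𝓡 8) x x) (tangentEquiv x v) = tangentEquiv x (K x v) := by
  have h := K.inChart_rep (mem_extChartAt_target x) (constField x (tangentEquiv x v))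
  rwa [rep_self, rep_self, constField_self] at h

theorem BilinField.inChart_self (g : BilinField M) (v w : TangentSpace (𝓡 8) x) :
    g.inChart x (extChartAt (𝓡 8) x x) (tangentEquiv x v) (tangentEquiv x w) = g x v w := by
  have e : ∀ y ∈ (extChartAt (𝓡 8) x).source, ∀ v w : TangentSpace (𝓡 8) y,
      g.inChart x (extChartAt (𝓡 8) x y) (chartMap x y v) (chartMap x y w) = g y v w :=
    fun y hy => by
      obtain ⟨z, hz, rfl⟩ : ∃ z ∈ (extChartAt (𝓡 8) x).target, (extChartAt (𝓡 8) x).symm z = y :=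
        ⟨_, (extChartAt (𝓡 8) x).map_source hy, (extChartAt (𝓡 8) x).left_inv hy⟩
      intro v w
      rw [(extChartAt (𝓡 8) x).right_inv hz, BilinField.inChart_apply, chartInv_chartMap hz,
        chartInv_chartMap hz]
  rw [tangentEquiv_apply, tangentEquiv_apply]
  exact e x (mem_extChartAt_source x) v w

theorem BilinField.IsSmooth.mdifferentiableAt_apply {g : BilinField M} (hg : g.IsSmooth)
    {Y Z : ∀ y : M, TangentSpace (𝓡 8) y} (hY : DiffAt Y x) (hZ : DiffAt Z x) :
    MDifferentiableAt (𝓡 8) 𝓘(ℝ, ℝ) (fun y => g y (Y y) (Z y)) x := by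
  have : MDifferentiableAt (𝓡 8) ((𝓡 8).prod 𝓘(ℝ))
      (fun m ↦ Bundle.TotalSpace.mk' ℝ (E := Bundle.Trivial M ℝ) m (g m (Y m) (Z m))) x :=
    MDifferentiableAt.clm_bundle_apply₂ (F₁ := Model) (F₂ := Model)
      ((hg x).mdifferentiableAt (by simp)) hY hZ
  simp only [mdifferentiableAt_totalSpace] at this
  exact this.2

theorem EndoField.IsSmooth.diffAt_apply {K : EndoField M} (hK : K.IsSmooth)
    {Y : ∀ y : M, TangentSpace (𝓡 8) y} (hY : DiffAt Y x) : DiffAt (fun y => K y (Y y)) x :=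
  MDifferentiableAt.clm_bundle_apply (F₁ := Model) (F₂ := Model)
      ((hK x).mdifferentiableAt (by simp)) hY

theorem BilinField.IsSmooth.differentiableAt_inChart {g : BilinField M} (hg : g.IsSmooth) :
    DifferentiableAt ℝ (g.inChart x) (extChartAt (𝓡 8) x x) := by
  refine differentiableAt_clm_of_apply fun a => differentiableAt_clm_of_apply fun b => ?_
  refine (mdifferentiableAt_iff_comp_symm.1 (hg.mdifferentiableAt_apply
    (diffAt_constField a) (diffAt_constField b))).congr_of_eventuallyEq ?_
  filter_upwards [eventually_mem_target] with z hz
  rw [← rep_constField (x := x) a hz, ← rep_constField (x := x) b hz, g.inChart_rep hz]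
  simp only [rep_constField _ hz]; rfl

theorem EndoField.IsSmooth.differentiableAt_inChart {K : EndoField M} (hK : K.IsSmooth) :
    DifferentiableAt ℝ (K.inChart x) (extChartAt (𝓡 8) x x) := by
  refine differentiableAt_clm_of_apply fun a => ?_
  refine ((diffAt_iff _).1 (hK.diffAt_apply (diffAt_constField a))).congr_of_eventuallyEq ?_
  filter_upwards [eventually_mem_target] with z hz
  rw [← K.inChart_rep hz, rep_constField _ hz]

theorem BilinField.IsSmooth.isParallel {g : BilinField M} (hg : g.IsSmooth)
    {cov : AffineConnection M} {Γ : M → Model →L[ℝ] Model →L[ℝ] Model} (h : HasChristoffel cov Γ)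
    (hΓ : ∀ x u a b, fderiv ℝ (g.inChart x) (extChartAt (𝓡 8) x x) u a b
      = g.inChart x (extChartAt (𝓡 8) x x) (Γ x u a) b
        + g.inChart x (extChartAt (𝓡 8) x x) a (Γ x u b)) : g.IsParallel cov := by
  intro x Y Z hY hZ v
  have hD := (hg.differentiableAt_inChart (x := x)).hasFDerivAt.clm_apply
    ((diffAt_iff Y).1 hY).hasFDerivAt |>.clm_apply ((diffAt_iff Z).1 hZ).hasFDerivAt
  have hD' := hD.congr_of_eventuallyEq (f₁ := (fun y => g y (Y y) (Z y)) ∘ (extChartAt (𝓡 8) x).symm)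
    (eventually_mem_target.mono fun z hz => (g.inChart_rep hz Y Z).symm)
  rw [mvfderiv_eq hD' v]
  simp only [add_apply, ContinuousLinearMap.comp_apply, ContinuousLinearMap.flip_apply, hΓ,
    rep_self]
  rw [← g.inChart_self, ← g.inChart_self, h x Y hY, h x Z hZ]
  simp only [map_add, add_apply]
  ring

theorem EndoField.IsSmooth.isParallel {K : EndoField M} (hK : K.IsSmooth)
    {cov : AffineConnection M} {Γ : M → Model →L[ℝ] Model →L[ℝ] Model} (h : HasChristoffel cov Γ)
    (hΓ : ∀ x u a, fderiv ℝ (K.inChart x) (extChartAt (𝓡 8) x x) u a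
        + Γ x u (K.inChart x (extChartAt (𝓡 8) x x) a)
      = K.inChart x (extChartAt (𝓡 8) x x) (Γ x u a)) : K.IsParallel cov := by
  intro x Y hY v
  have hD := (hK.differentiableAt_inChart (x := x)).hasFDerivAt.clm_apply
    ((diffAt_iff Y).1 hY).hasFDerivAt
  have hD' := (hD.congr_of_eventuallyEq (f₁ := rep x fun y => K y (Y y))
    (eventually_mem_target.mono fun z hz => (K.inChart_rep hz Y).symm)).fderiv
  apply (tangentEquiv x).injective
  rw [h x _ (hK.diffAt_apply hY), hD', ← K.inChart_self (Y x), ← K.inChart_self (cov Y x v),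
    h x Y hY, map_add, ← hΓ]
  simp only [add_apply, ContinuousLinearMap.comp_apply, ContinuousLinearMap.flip_apply, rep_self]
  abel

end TensorsInChart

/-! ## Closed Cayley forms -/

section Cayley

variable {E : Type*} [NormedAddCommGroup E] [NormedSpace ℝ E]

/-- The exterior derivative commutes with linear maps of the coefficients. -/
theorem extDeriv_compContinuousAlternatingMap {F G : Type*} [NormedAddCommGroup F]
    [NormedSpace ℝ F] [NormedAddCommGroup G] [NormedSpace ℝ G] {k : ℕ} {f : E → E [⋀^Fin k]→L[ℝ] F}
    {y₀ : E} (hf : DifferentiableAt ℝ f y₀) (A : F →L[ℝ] G) (v : Fin (k + 1) → E) :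
    extDeriv (fun z => A.compContinuousAlternatingMap (f z)) y₀ v = A (extDeriv f y₀ v) := by
  have h : HasFDerivAt (fun z => A.compContinuousAlternatingMap (f z)) _ y₀ :=
    (ContinuousLinearMap.compContinuousAlternatingMapCLM ℝ E F G (Fin k) A).hasFDerivAt.comp y₀ hf.hasFDerivAt
  rw [extDeriv, extDeriv, h.fderiv, alternatizeUncurryFin_apply, alternatizeUncurryFin_apply,
    map_sum]
  refine Finset.sum_congr rfl fun i _ => ?_
  rw [map_zsmul]
  rfl

theorem differentiableAt_compContinuousAlternatingMap {F G : Type*} [NormedAddCommGroup F]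
    [NormedSpace ℝ F] [NormedAddCommGroup G] [NormedSpace ℝ G] {k : ℕ} {f : E → E [⋀^Fin k]→L[ℝ] F}
    {y₀ : E} (hf : DifferentiableAt ℝ f y₀) (A : F →L[ℝ] G) :
    DifferentiableAt ℝ (fun z => A.compContinuousAlternatingMap (f z)) y₀ :=
  (ContinuousLinearMap.compContinuousAlternatingMapCLM ℝ E F G (Fin k) A).differentiableAt.comp y₀ hf

theorem extDeriv_smul_add_smul_add_smul_complexify {k : ℕ} {P Q : E → E [⋀^Fin k]→L[ℝ] ℂ}
    {W : E → E [⋀^Fin k]→L[ℝ] ℝ} {y₀ : E} (hP : DifferentiableAt ℝ P y₀)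
    (hQ : DifferentiableAt ℝ Q y₀) (hW : DifferentiableAt ℝ W y₀) (a b c : ℂ)
    (v : Fin (k + 1) → E) :
    extDeriv (fun z => a • P z + b • Q z + c • complexify (W z)) y₀ v
      = a * extDeriv P y₀ v + b * extDeriv Q y₀ v + c * (extDeriv W y₀ v : ℂ) := by
  have hsm : ∀ (r : ℂ) {R : E → E [⋀^Fin k]→L[ℝ] ℂ}, DifferentiableAt ℝ R y₀ →
      DifferentiableAt ℝ (fun z => r • R z) y₀ ∧
        extDeriv (fun z => r • R z) y₀ v = r * extDeriv R y₀ v := fun r R hR =>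
    ⟨differentiableAt_compContinuousAlternatingMap hR (ContinuousLinearMap.mul ℝ ℂ r),
      extDeriv_compContinuousAlternatingMap hR (ContinuousLinearMap.mul ℝ ℂ r) v⟩
  have hC : DifferentiableAt ℝ (fun z => complexify (W z)) y₀ :=
    differentiableAt_compContinuousAlternatingMap hW Complex.ofRealCLM
  rw [extDeriv_fun_add ((hsm a hP).1.fun_add (hsm b hQ).1) (hsm c hC).1,
    extDeriv_fun_add (hsm a hP).1 (hsm b hQ).1]
  have h1 : extDeriv (fun z => complexify (W z)) y₀ v = (extDeriv W y₀ v : ℂ) :=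
    extDeriv_compContinuousAlternatingMap hW Complex.ofRealCLM v
  rw [ContinuousAlternatingMap.add_apply, ContinuousAlternatingMap.add_apply, (hsm a hP).2,
    (hsm b hQ).2, (hsm c hC).2, h1]

namespace AdaptedGerm

variable {lam : ℂ} {ε : ℝ} {c : ℂ} {y₀ : E} {g : E → E →L[ℝ] E →L[ℝ] ℝ}
    {L : E → E →L[ℝ] E} {w : E → E [⋀^Fin 2]→L[ℝ] ℝ} {P Q : E → E [⋀^Fin 4]→L[ℝ] ℂ}

/-- The difference of the two relations is (a − b)(dP − dQ) = 0. Types then give dP = dQ = 0, the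
remaining relation is r d(w∧w) = 0, and injectivity of the wedge with w finishes. -/
theorem swap_smul_eq_zero (h : AdaptedGerm lam ε c y₀ g L w P Q) (hdim : Module.finrank ℝ E = 8)
    {a b r : ℂ} (hab : a ≠ b) (hr : r ≠ 0)
    (h₁ : ∀ v, a * extDeriv P y₀ v + b * extDeriv Q y₀ v
      + r * (extDeriv (fun z => wedge₂₂ (w z) (w z)) y₀ v : ℂ) = 0)
    (h₂ : ∀ v, b * extDeriv P y₀ v + a * extDeriv Q y₀ v
      + r * (extDeriv (fun z => wedge₂₂ (w z) (w z)) y₀ v : ℂ) = 0) :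
    extDeriv w y₀ = 0 ∧ extDeriv P y₀ = 0 ∧ extDeriv Q y₀ = 0 := by
  have : FiniteDimensional ℝ E := .of_finrank_eq_succ hdim
  have hPQ : extDeriv P y₀ = extDeriv Q y₀ := by
    ext v
    have : (a - b) * (extDeriv P y₀ v - extDeriv Q y₀ v) = 0 := by linear_combination h₁ v - h₂ v
    exact sub_eq_zero.1 ((mul_eq_zero.1 this).resolve_left (sub_ne_zero.2 hab))
  have hP := h.extDeriv_eq_zero_of_eq hPQ
  have hQ := hPQ ▸ hP
  refine ⟨extDeriv_eq_zero_of_extDeriv_wedge₂₂_self hdim h.diff_w (fun x hx => ?_) ?_, hP, hQ⟩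
  · have had := h.adapted.self_of_nhds
    have h1 := had.nondeg (L y₀ x) fun y => by rw [← had.two_form_apply, hx]
    have h2 := had.sq_apply x
    rw [h1, map_zero] at h2
    exact (smul_eq_zero.1 h2.symm).resolve_left h.ne_zero
  · ext v
    have := h₁ v
    rw [hP, hQ] at this
    simpa [hr] using this

end AdaptedGerm

end Cayley

/-! ### From germs to tensor fields on the manifold. -/

section Global

variable {M : Type*} [TopologicalSpace M] [ChartedSpace (EuclideanSpace ℝ (Fin 8)) M]
  [IsManifold (𝓡 8) ∞ M]

/-- Smooth tensor fields which are adapted at each point. -/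
structure AdaptedFields (lam : ℂ) (ε : ℝ) (c : ℂ) (g : BilinField M) (L : EndoField M)
    (w : Form M 2 ℝ) (P Q : Form M 4 ℂ) : Prop where
  sq_lam : lam * lam = ε
  ne_zero : ε ≠ 0
  g_smooth : g.IsSmooth
  L_smooth : L.IsSmooth
  w_smooth : w.IsSmooth
  P_smooth : P.IsSmooth
  Q_smooth : Q.IsSmooth
  adapted : ∀ x, IsAdapted lam ε c (fun u v => g x u v) (L x) (w x) (P x) (Q x)

namespace AdaptedFields

variable {lam : ℂ} {ε : ℝ} {c : ℂ} {g : BilinField M} {L : EndoField M}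
    {w : Form M 2 ℝ} {P Q : Form M 4 ℂ}

theorem adaptedGerm (h : AdaptedFields lam ε c g L w P Q) (x : M) :
    AdaptedGerm lam ε c (extChartAt (𝓡 8) x x) (g.inChart x) (L.inChart x) (w.inChart x)
      (P.inChart x) (Q.inChart x) where
  sq_lam := h.sq_lam
  ne_zero := h.ne_zero
  diff_g := h.g_smooth.differentiableAt_inChart
  diff_L := h.L_smooth.differentiableAt_inChart
  diff_w := differentiableAt_inChart h.w_smooth
  diff_P := differentiableAt_inChart h.P_smooth
  diff_Q := differentiableAt_inChart h.Q_smooth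
  adapted := by
    filter_upwards [eventually_mem_target] with z hz
    exact (h.adapted ((extChartAt (𝓡 8) x).symm z)).comp (chartEquiv hz)

theorem exists_connection (h : AdaptedFields lam ε c g L w P Q) (hw : w.d = 0) (hP : P.d = 0)
    (hQ : Q.d = 0) : ∃ cov : AffineConnection M, cov.torsion = 0 ∧ g.IsParallel cov ∧
      L.IsParallel cov ∧ w.IsParallel cov ∧ P.IsParallel cov ∧ Q.IsParallel cov := by
  choose Γ hs hg hL hw' hP' hQ' using fun x => (h.adaptedGerm x).exists_connection
    (d_apply_eq_zero_iff.1 (congrFun hw x)) (d_apply_eq_zero_iff.1 (congrFun hP x))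
    (d_apply_eq_zero_iff.1 (congrFun hQ x))
  obtain ⟨cov, hcov⟩ := exists_connection_hasChristoffel Γ
  exact ⟨cov, hcov.torsion_eq_zero_iff.2 hs, h.g_smooth.isParallel hcov hg,
    h.L_smooth.isParallel hcov hL, (isParallel_iff h.w_smooth hcov).2 hw',
    (isParallel_iff h.P_smooth hcov).2 hP', (isParallel_iff h.Q_smooth hcov).2 hQ'⟩

theorem d_apply_eq_zero_iff_extDeriv (h : AdaptedFields lam ε c g L w P Q) {a b r : ℂ}
    {Φ : Form M 4 ℂ} (hΦ : ∀ x, Φ x = a • P x + b • Q x + r • complexify (wedge₂₂ (w x) (w x)))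
    (x : M) : Φ.d x = 0 ↔ ∀ v, a * extDeriv (P.inChart x) (extChartAt (𝓡 8) x x) v
      + b * extDeriv (Q.inChart x) (extChartAt (𝓡 8) x x) v
      + r * (extDeriv (fun z => wedge₂₂ (w.inChart x z) (w.inChart x z))
          (extChartAt (𝓡 8) x x) v : ℂ) = 0 := by
  have e : Φ.inChart x = fun z => a • P.inChart x z + b • Q.inChart x z
      + r • complexify (wedge₂₂ (w.inChart x z) (w.inChart x z)) := by
    funext z
    ext v
    have hv : ∀ i j, w.inChart x z ![v i, v j]
        = w ((extChartAt (𝓡 8) x).symm z) ![chartInv x z (v i), chartInv x z (v j)] := fun i j =>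
      congrArg (w ((extChartAt (𝓡 8) x).symm z)) (by ext k : 1; fin_cases k <;> rfl)
    have hc : wedge₂₂ (w.inChart x z) (w.inChart x z) v
        = wedge₂₂ (w ((extChartAt (𝓡 8) x).symm z)) (w ((extChartAt (𝓡 8) x).symm z))
          fun i => chartInv x z (v i) := by
      rw [wedge₂₂_apply]
      simp only [hv]
      rfl
    rw [Form.inChart, hΦ]
    exact congrArg (fun s : ℝ => a * P.inChart x z v + b * Q.inChart x z v + r * (s : ℂ)) hc.symm
  have hG := h.adaptedGerm x
  have hW := (hasFDerivAt_wedge₂₂_self hG.diff_w).differentiableAt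
  rw [d_apply_eq_zero_iff, e]
  constructor
  · intro h0 v
    rw [← extDeriv_smul_add_smul_add_smul_complexify hG.diff_P hG.diff_Q hW, h0]; rfl
  · intro h0
    ext v
    rw [extDeriv_smul_add_smul_add_smul_complexify hG.diff_P hG.diff_Q hW, h0]; rfl

/-- If the exterior derivatives of the 4-forms and of the square of the 2-form satisfy a conjugation
symmetry, closedness of the Cayley form is closedness of all the forms. -/
theorem d_eq_zero_iff (h : AdaptedFields lam ε c g L w P Q) {a b r : ℂ} {Φ : Form M 4 ℂ}
    (hab : a ≠ b) (hr : r ≠ 0)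
    (hΦ : ∀ x, Φ x = a • P x + b • Q x + r • complexify (wedge₂₂ (w x) (w x)))
    (hconj : ∀ x v, starRingEnd ℂ (a * extDeriv (P.inChart x) (extChartAt (𝓡 8) x x) v
        + b * extDeriv (Q.inChart x) (extChartAt (𝓡 8) x x) v)
      = b * extDeriv (P.inChart x) (extChartAt (𝓡 8) x x) v
        + a * extDeriv (Q.inChart x) (extChartAt (𝓡 8) x x) v) (hr' : starRingEnd ℂ r = r) :
    Φ.d = 0 ↔ w.d = 0 ∧ P.d = 0 ∧ Q.d = 0 := by
  constructor
  · intro h0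
    have : ∀ x, w.d x = 0 ∧ P.d x = 0 ∧ Q.d x = 0 := fun x => by
      simp only [d_apply_eq_zero_iff]
      have h1 := (h.d_apply_eq_zero_iff_extDeriv hΦ x).1 (congrFun h0 x)
      refine (h.adaptedGerm x).swap_smul_eq_zero (by simp) hab hr h1 fun v => ?_
      rw [← hconj]
      -- The term in w∧w is real, so conjugating the closedness equation only exchanges a and b, as
      -- `swap_smul_eq_zero` requires.
      have h2 := congrArg (starRingEnd ℂ) (h1 v)
      rw [map_add, map_mul, hr', Complex.conj_ofReal, map_zero] at h2
      exact h2
    exact ⟨funext fun x => (this x).1, funext fun x => (this x).2.1, funext fun x => (this x).2.2⟩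
  · rintro ⟨hw, hP, hQ⟩
    funext x
    refine (h.d_apply_eq_zero_iff_extDeriv hΦ x).2 fun v => ?_
    have hw' := d_apply_eq_zero_iff.1 (congrFun hw x)
    rw [d_apply_eq_zero_iff.1 (congrFun hP x), d_apply_eq_zero_iff.1 (congrFun hQ x)]
    have h5 : v = ![v 0, v 1, v 2, v 3, v 4] := by ext i; fin_cases i <;> rfl
    rw [h5, extDeriv_wedge₂₂_self (h.adaptedGerm x).diff_w, hw']
    simp [wedge₂₃]

end AdaptedFields

end Global

/-! ## The model structures are adapted -/

section Models

variable {V : Type*} [AddCommGroup V] [Module ℝ V]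

/-- Tensors built from eigencovectors of the endomorphism are adapted. -/
theorem isAdapted_of_covectors {lam : ℂ} {ε : ℝ} {c : ℂ} {g : V → V → ℝ} {L : V → V}
    {w : (Fin 2 → V) → ℝ} {P Q : (Fin 4 → V) → ℂ} (a b : Fin 4 → V → ℂ) (s : Fin 4 → ℂ)
    (f : Fin 4 → V) (hP : ∀ v, P v = wedgeCovectors a v) (hQ : ∀ v, Q v = wedgeCovectors b v)
    (hs : c * ∏ k, s k = 1) (haf : ∀ k l, a k (f l) = if k = l then 1 else 0)
    (hbf : ∀ k l, b k (f l) = if k = l then 1 else 0)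
    (haL : ∀ k x, a k (L x) = lam * a k x) (hbL : ∀ k x, b k (L x) = -lam * b k x)
    (hab : ∀ x y, lam * (g x y : ℂ) + (w ![x, y] : ℂ) = ∑ k, s k * a k x * b k y)
    (hinj : ∀ x, (∀ k, a k x = 0) → (∀ k, b k x = 0) → x = 0)
    (hL : ∀ x, L (L x) = ε • x) (hw : ∀ x y, w ![x, y] = g (L x) y)
    (hsymm : ∀ x y, g x y = g y x) (hnd : ∀ x, (∀ y, g x y = 0) → x = 0) :
    IsAdapted lam ε c g L w P Q := by
  have htype : ∀ (a : Fin 4 → V → ℂ) (r : ℂ), (∀ k x, a k (L x) = r * a k x) → ∀ v j,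
      wedgeCovectors a (update v j (L (v j))) = r * wedgeCovectors a v := fun a r ha v j => by
    have e : (Matrix.of fun i k => a i (update v j (L (v j)) k))
        = (Matrix.of fun i k => a i (v k)).updateCol j (r • fun i => a i (v j)) := by
      ext i k
      rcases eq_or_ne k j with rfl | hk
      · simp [ha]
      · simp [hk]
    have e' : (Matrix.of fun i k => a i (v k)).updateCol j (fun i => a i (v j))
        = Matrix.of fun i k => a i (v k) := Matrix.updateCol_eq_self _ _
    unfold wedgeCovectors
    rw [e, Matrix.det_updateCol_smul, e']
  have hone : ∀ a : Fin 4 → V → ℂ, (∀ k l, a k (f l) = if k = l then 1 else 0) →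
      wedgeCovectors a f = 1 := fun a ha => by
    have : (Matrix.of fun i j => a i (f j)) = 1 := by
      ext i j; simp [ha, Matrix.one_apply]
    rw [wedgeCovectors, this, Matrix.det_one]
  -- Filling the other three arguments with the dual vectors other than f k reduces the determinant
  -- to ± a k x.
  have hzero : ∀ a : Fin 4 → V → ℂ, (∀ k l, a k (f l) = if k = l then 1 else 0) →
      ∀ x, (∀ p q r, wedgeCovectors a ![x, p, q, r] = 0) → ∀ k, a k x = 0 := fun a ha x hx k => by
    fin_cases k
    · simpa [wedgeCovectors, Matrix.det_succ_row_zero, Fin.sum_univ_succ, ha, Fin.succAbove] using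
        hx (f 1) (f 2) (f 3)
    · simpa [wedgeCovectors, Matrix.det_succ_row_zero, Fin.sum_univ_succ, ha, Fin.succAbove] using
        hx (f 0) (f 2) (f 3)
    · simpa [wedgeCovectors, Matrix.det_succ_row_zero, Fin.sum_univ_succ, ha, Fin.succAbove] using
        hx (f 0) (f 1) (f 3)
    · simpa [wedgeCovectors, Matrix.det_succ_row_zero, Fin.sum_univ_succ, ha, Fin.succAbove] using
        hx (f 0) (f 1) (f 2)
  exact {
    sq_apply := hL
    two_form_apply := hw
    symm := hsymm
    nondeg := hnd
    type_P := fun v j => by rw [hP, hP, htype a lam haL]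
    type_Q := fun v j => by rw [hQ, hQ, htype b (-lam) hbL]
    ne_P := ⟨f, by rw [hP, hone a haf]; exact one_ne_zero⟩
    ne_Q := ⟨f, by rw [hQ, hone b hbf]; exact one_ne_zero⟩
    inj := fun x h₁ h₂ => by
      simp only [hP, hQ] at h₁ h₂
      exact hinj x (hzero a haf x h₁) (hzero b hbf x h₂)
    det := fun y x => by
      -- The expansion of λg + w in eigencovectors factors the matrix as Aᵀ · diag(s) · B, where det
      -- A and det B are the values of P and Q.
      have : (Matrix.of fun i j => lam * (g (y i) (x j) : ℂ) + (w ![y i, x j] : ℂ))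
          = (Matrix.of fun i j => a i (y j)).transpose * Matrix.diagonal s
            * Matrix.of fun i j => b i (x j) := by
        ext i j
        rw [Matrix.of_apply, hab, Matrix.mul_apply]
        simp only [Matrix.mul_diagonal, Matrix.transpose_apply, Matrix.of_apply]
        exact Finset.sum_congr rfl fun k _ => by ring
      rw [this, Matrix.det_mul, Matrix.det_mul, Matrix.det_transpose, Matrix.det_diagonal, hP, hQ]
      unfold wedgeCovectors
      linear_combination (-(Matrix.det (Matrix.of fun i j => a i (y j)))
        * Matrix.det (Matrix.of fun i j => b i (x j))) * hs }

omit [AddCommGroup V] [Module ℝ V] in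
theorem ofReal_wedgeCovectors {k : ℕ} (α : Fin k → V → ℝ) (v : Fin k → V) :
    ((wedgeCovectors α v : ℝ) : ℂ) = wedgeCovectors (fun i x => (α i x : ℂ)) v := by
  unfold wedgeCovectors
  rw [← Complex.ofRealHom_eq_coe, RingHom.map_det]
  rfl

variable (e : Module.Basis (Fin 8) ℝ V)

theorem modelMetric_symm (x y : V) : modelMetric e x y = modelMetric e y x := by
  unfold modelMetric; ring

theorem eq_zero_of_coord_eq_zero {x : V} (h : ∀ i, e.coord i x = 0) : x = 0 :=
  e.repr.injective (Finsupp.ext fun i => by simpa using h i)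

theorem coord_basis (i j : Fin 8) : e.coord i (e j) = if i = j then 1 else 0 := by
  simp [Finsupp.single_apply, eq_comm]

theorem modelMetric_nondeg (x : V) (h : ∀ y, modelMetric e x y = 0) : x = 0 := by
  refine eq_zero_of_coord_eq_zero e fun i => ?_
  have := h (e i)
  simp only [modelMetric, coord_basis] at this
  fin_cases i <;> simpa using this

theorem modelTwo_apply (i j : Fin 8) (x y : V) :
    modelTwo e i j ![x, y] = e.coord i x * e.coord j y - e.coord j x * e.coord i y := by
  simp [modelTwo, wedgeCovectors, Matrix.det_fin_two]
  ring

variable {e}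

/-- The factors of Ω₊ and Ω₋ are null covectors on which K acts as 1 and −1, and g + ω_r = −∑ aₖ ⊗
bₖ; hence all weights are −1, with product 1. -/
theorem isAdapted_modelOmegaPlus_modelOmegaMinus {K : V →ₗ[ℝ] V} (hK : ∀ i, K (e i) = e (i + 4)) :
    IsAdapted 1 1 1 (modelMetric e) K (modelOmegaR e) (fun v => (modelOmegaPlus e v : ℂ))
      (fun v => (modelOmegaMinus e v : ℂ)) := by
  have hc : ∀ i x, e.coord i (K x) = e.coord (i + 4) x := fun i x => by
    have : e.coord i ∘ₗ K = e.coord (i + 4) := e.ext fun j => by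
      simp only [LinearMap.comp_apply, hK, coord_basis]
      congr 1; revert i j; decide
    exact LinearMap.congr_fun this x
  have hc0 : ∀ x, e.coord 0 (K x) = e.coord 4 x := hc 0
  have hc1 : ∀ x, e.coord 1 (K x) = e.coord 5 x := hc 1
  have hc2 : ∀ x, e.coord 2 (K x) = e.coord 6 x := hc 2
  have hc3 : ∀ x, e.coord 3 (K x) = e.coord 7 x := hc 3
  have hc4 : ∀ x, e.coord 4 (K x) = e.coord 0 x := hc 4
  have hc5 : ∀ x, e.coord 5 (K x) = e.coord 1 x := hc 5
  have hc6 : ∀ x, e.coord 6 (K x) = e.coord 2 x := hc 6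
  have hc7 : ∀ x, e.coord 7 (K x) = e.coord 3 x := hc 7
  refine isAdapted_of_covectors
    (fun k x => (((![e.coord 4 + e.coord 0, e.coord 1 + e.coord 5, e.coord 2 + e.coord 6,
      e.coord 3 + e.coord 7] : Fin 4 → V → ℝ) k x : ℝ) : ℂ))
    (fun k x => (((![e.coord 4 - e.coord 0, e.coord 1 - e.coord 5, e.coord 2 - e.coord 6,
      e.coord 3 - e.coord 7] : Fin 4 → V → ℝ) k x : ℝ) : ℂ)) (fun _ => -1) ![e 4, e 1, e 2, e 3]
    (fun v => ?_) (fun v => ?_) (by norm_num) (fun k l => ?_) (fun k l => ?_) (fun k x => ?_)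
    (fun k x => ?_) (fun x y => ?_) (fun x ha hb => ?_) (fun x => ?_) (fun x y => ?_)
    (modelMetric_symm e) (modelMetric_nondeg e)
  · exact ofReal_wedgeCovectors _ v
  · exact ofReal_wedgeCovectors _ v
  · fin_cases k <;> fin_cases l <;> simp
  · fin_cases k <;> fin_cases l <;> simp
  · fin_cases k <;> simp [-Module.Basis.coord_apply, hc0, hc1, hc2, hc3, hc4, hc5, hc6, hc7, add_comm]
  · fin_cases k <;> simp [-Module.Basis.coord_apply, hc0, hc1, hc2, hc3, hc4, hc5, hc6, hc7]
  · simp only [modelMetric, modelOmegaR, modelTwo_apply, Fin.sum_univ_four]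
    simp [-Module.Basis.coord_apply]
    ring
  · have h0 := ha 0; have h1 := ha 1; have h2 := ha 2; have h3 := ha 3
    have k0 := hb 0; have k1 := hb 1; have k2 := hb 2; have k3 := hb 3
    norm_cast at h0 h1 h2 h3 k0 k1 k2 k3
    simp [-Module.Basis.coord_apply] at h0 h1 h2 h3 k0 k1 k2 k3
    refine eq_zero_of_coord_eq_zero e fun i => ?_
    fin_cases i <;> simp only [Fin.mk_one, Fin.zero_eta, Fin.reduceFinMk] <;> linarith
  · rw [one_smul, ← sub_eq_zero]
    refine eq_zero_of_coord_eq_zero e fun i => ?_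
    rw [map_sub, hc, hc, sub_eq_zero]
    exact congrArg (fun k => e.coord k x) (by revert i; decide)
  · simp only [modelMetric, modelOmegaR, modelTwo_apply, hc0, hc1, hc2, hc3, hc4, hc5, hc6, hc7]
    ring

/-- The factors αₖ of Ω satisfy αₖ ∘ J = i αₖ, and i g + ω is the sum of ±i times αₖ tensor its
conjugate. The sign is that of g on the corresponding plane: plus for (7,0) and (5,6), minus for
(1,2) and (3,4). -/
theorem isAdapted_modelOmegaC {J : V →ₗ[ℝ] V}
    (hJ : J (e 1) = -e 2 ∧ J (e 2) = e 1 ∧ J (e 3) = -e 4 ∧ J (e 4) = e 3 ∧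
      J (e 5) = e 6 ∧ J (e 6) = -e 5 ∧ J (e 7) = e 0 ∧ J (e 0) = -e 7) :
    IsAdapted Complex.I (-1) 1 (modelMetric e) J (modelOmega e) (modelOmegaC e)
      (fun v => starRingEnd ℂ (modelOmegaC e v)) := by
  obtain ⟨j1, j2, j3, j4, j5, j6, j7, j0⟩ := hJ
  have hc : ∀ (φ ψ : V →ₗ[ℝ] ℝ), (∀ i, φ (J (e i)) = ψ (e i)) → ∀ x, φ (J x) = ψ x :=
    fun φ ψ h x => LinearMap.congr_fun (e.ext h : φ ∘ₗ J = ψ) x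
  have hc0 : ∀ x, e.coord 0 (J x) = e.coord 7 x := hc _ _ fun i => by
    fin_cases i <;> simp [j0, j1, j2, j3, j4, j5, j6, j7]
  have hc1 : ∀ x, e.coord 1 (J x) = e.coord 2 x := hc _ _ fun i => by
    fin_cases i <;> simp [j0, j1, j2, j3, j4, j5, j6, j7]
  have hc2 : ∀ x, e.coord 2 (J x) = -e.coord 1 x := hc _ (-e.coord 1) fun i => by
    fin_cases i <;> simp [j0, j1, j2, j3, j4, j5, j6, j7]
  have hc3 : ∀ x, e.coord 3 (J x) = e.coord 4 x := hc _ _ fun i => by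
    fin_cases i <;> simp [j0, j1, j2, j3, j4, j5, j6, j7]
  have hc4 : ∀ x, e.coord 4 (J x) = -e.coord 3 x := hc _ (-e.coord 3) fun i => by
    fin_cases i <;> simp [j0, j1, j2, j3, j4, j5, j6, j7]
  have hc5 : ∀ x, e.coord 5 (J x) = -e.coord 6 x := hc _ (-e.coord 6) fun i => by
    fin_cases i <;> simp [j0, j1, j2, j3, j4, j5, j6, j7]
  have hc6 : ∀ x, e.coord 6 (J x) = e.coord 5 x := hc _ _ fun i => by
    fin_cases i <;> simp [j0, j1, j2, j3, j4, j5, j6, j7]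
  have hc7 : ∀ x, e.coord 7 (J x) = -e.coord 0 x := hc _ (-e.coord 0) fun i => by
    fin_cases i <;> simp [j0, j1, j2, j3, j4, j5, j6, j7]
  have hI := Complex.I_mul_I
  refine isAdapted_of_covectors
    ![modelCovector e 7 0 1, modelCovector e 1 2 (-1), modelCovector e 3 4 (-1),
      modelCovector e 5 6 1]
    (fun k x => starRingEnd ℂ (![modelCovector e 7 0 1, modelCovector e 1 2 (-1),
      modelCovector e 3 4 (-1), modelCovector e 5 6 1] k x))
    ![Complex.I, -Complex.I, -Complex.I, Complex.I] ![e 7, e 1, e 3, e 5]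
    (fun v => rfl) (fun v => ?_) ?_ (fun k l => ?_) (fun k l => ?_) (fun k x => ?_)
    (fun k x => ?_) (fun x y => ?_) (fun x ha hb => ?_) (fun x => ?_) (fun x y => ?_)
    (modelMetric_symm e) (modelMetric_nondeg e)
  · exact (starRingEnd ℂ).map_det _
  · simp [Fin.prod_univ_four]
  · fin_cases k <;> fin_cases l <;> simp [modelCovector]
  · fin_cases k <;> fin_cases l <;> simp [modelCovector]
  · fin_cases k <;> simp [-Module.Basis.coord_apply, modelCovector, hc0, hc1, hc2, hc3, hc4, hc5, hc6, hc7] <;>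
      ring_nf <;> simp
  · fin_cases k <;> simp [-Module.Basis.coord_apply, modelCovector, hc0, hc1, hc2, hc3, hc4, hc5, hc6, hc7] <;>
      ring_nf <;> simp
  · simp only [modelMetric, modelOmega, modelTwo_apply, Fin.sum_univ_four]
    simp [-Module.Basis.coord_apply, modelCovector]
    ring_nf
    simp
    ring
  · have h0 := ha 0; have h1 := ha 1; have h2 := ha 2; have h3 := ha 3
    simp [-Module.Basis.coord_apply, modelCovector, Complex.ext_iff] at h0 h1 h2 h3
    refine eq_zero_of_coord_eq_zero e fun i => ?_
    fin_cases i <;> simp only [Fin.mk_one, Fin.zero_eta, Fin.reduceFinMk, h0, h1, h2, h3]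
  · rw [neg_smul, one_smul, ← sub_eq_zero, sub_neg_eq_add]
    refine eq_zero_of_coord_eq_zero e fun i => ?_
    fin_cases i <;> simp [-Module.Basis.coord_apply, hc0, hc1, hc2, hc3, hc4, hc5, hc6, hc7]
  · simp only [modelMetric, modelOmega, modelTwo_apply, hc0, hc1, hc2, hc3, hc4, hc5, hc6, hc7]
    ring

end Models

/-! ## Integrability of the two structures -/

section Coefficients

variable {M : Type*} [TopologicalSpace M] [ChartedSpace (EuclideanSpace ℝ (Fin 8)) M]
  {F G : Type*} [NormedAddCommGroup F] [NormedSpace ℝ F] [NormedAddCommGroup G] [NormedSpace ℝ G]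
  {k : ℕ} {η : Form M k F}

/-- Applying a linear map to the coefficients of a form. -/
def Form.mapCoeff (A : F →L[ℝ] G) (η : Form M k F) : Form M k G := fun x =>
  A.compContinuousAlternatingMap (η x)

theorem Form.IsSmooth.mapCoeff (A : F →L[ℝ] G) (hη : η.IsSmooth) : (η.mapCoeff A).IsSmooth :=
  fun x => (ContinuousLinearMap.compContinuousAlternatingMapCLM ℝ Model F G (Fin k)
    A).contDiff.comp_contDiffOn (hη x)

variable [IsManifold (𝓡 8) ∞ M]

omit [IsManifold (𝓡 8) ∞ M] in
theorem extDeriv_inChart_mapCoeff (A : F →L[ℝ] G) (hη : η.IsSmooth) (x : M)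
    (v : Fin (k + 1) → Model) :
    extDeriv ((η.mapCoeff A).inChart x) (extChartAt (𝓡 8) x x) v
      = A (extDeriv (η.inChart x) (extChartAt (𝓡 8) x x) v) :=
  extDeriv_compContinuousAlternatingMap (differentiableAt_inChart hη) A v

theorem d_mapCoeff_eq_zero (A : F →L[ℝ] G) (hη : η.IsSmooth) (h : η.d = 0) :
    (η.mapCoeff A).d = 0 := by
  funext x
  refine d_apply_eq_zero_iff.2 ?_
  ext v
  rw [extDeriv_inChart_mapCoeff A hη, d_apply_eq_zero_iff.1 (congrFun h x)]
  exact map_zero A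

theorem isParallel_mapCoeff (A : F →L[ℝ] G) (hη : η.IsSmooth) {cov : AffineConnection M}
    (h : η.IsParallel cov) : (η.mapCoeff A).IsParallel cov := by
  obtain ⟨Γ, hΓ⟩ := exists_hasChristoffel cov
  refine (isParallel_iff (hη.mapCoeff A) hΓ).2 fun x => ?_
  have h1 : HasFDerivAt ((η.mapCoeff A).inChart x) _ (extChartAt (𝓡 8) x x) :=
    (ContinuousLinearMap.compContinuousAlternatingMapCLM ℝ Model F G (Fin k) A).hasFDerivAt.comp
      _ (differentiableAt_inChart hη).hasFDerivAt
  rw [h1.fderiv, (isParallel_iff hη hΓ).1 h x]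
  ext u v
  simp only [ContinuousLinearMap.comp_apply,
    ContinuousAlternatingMap.fderivCompContinuousLinearMap_apply]
  refine (congrArg A (ContinuousAlternatingMap.fderivCompContinuousLinearMap_apply
    _ _ _ _)).trans ?_
  rw [map_sum]
  rfl

omit [IsManifold (𝓡 8) ∞ M] in
theorem mapCoeff_reCLM_ofRealCLM {k : ℕ} (η : Form M k ℝ) :
    (η.mapCoeff Complex.ofRealCLM).mapCoeff Complex.reCLM = η := by
  funext x; ext v; rfl

theorem d_ofReal_eq_zero_iff {k : ℕ} {η : Form M k ℝ} (hη : η.IsSmooth) :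
    (η.mapCoeff Complex.ofRealCLM).d = 0 ↔ η.d = 0 :=
  ⟨fun h => mapCoeff_reCLM_ofRealCLM η ▸ d_mapCoeff_eq_zero Complex.reCLM (hη.mapCoeff _) h,
    d_mapCoeff_eq_zero Complex.ofRealCLM hη⟩

end Coefficients

/-! ### The two structures as adapted fields, and their Cayley forms. -/

section Structures

variable {M : Type*} [TopologicalSpace M] [ChartedSpace (EuclideanSpace ℝ (Fin 8)) M]
  [IsManifold (𝓡 8) ∞ M]

namespace SL4Structure

variable (S : SL4Structure M)

theorem adaptedFields : AdaptedFields 1 1 1 S.g S.K S.omegaR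
    (S.OmegaPlus.mapCoeff Complex.ofRealCLM) (S.OmegaMinus.mapCoeff Complex.ofRealCLM) where
  sq_lam := by simp
  ne_zero := one_ne_zero
  g_smooth := S.g_smooth
  L_smooth := S.K_smooth
  w_smooth := S.omegaR_smooth
  P_smooth := S.OmegaPlus_smooth.mapCoeff _
  Q_smooth := S.OmegaMinus_smooth.mapCoeff _
  adapted x := by
    obtain ⟨e, hg, hK, hw, hP, hQ⟩ := S.exists_adapted_basis x
    have h := isAdapted_modelOmegaPlus_modelOmegaMinus (e := e) (K := (S.K x).toLinearMap) hK
    rw [← (funext₂ hg : (fun u v => S.g x u v) = modelMetric e),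
      ← (funext hw : ⇑(S.omegaR x) = modelOmegaR e),
      ← (funext hP : ⇑(S.OmegaPlus x) = modelOmegaPlus e),
      ← (funext hQ : ⇑(S.OmegaMinus x) = modelOmegaMinus e)] at h
    exact h

/-- The general theorem is stated for complex 4-forms, so the real forms are complexified to apply
it and recovered as real parts. -/
theorem isIntegrable_iff :
    S.IsIntegrable ↔ S.omegaR.d = 0 ∧ S.OmegaPlus.d = 0 ∧ S.OmegaMinus.d = 0 := by
  constructor
  · rintro ⟨cov, ht, -, -, hw, hP, hQ⟩
    exact ⟨d_eq_zero_of_isParallel S.omegaR_smooth ht hw,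
      d_eq_zero_of_isParallel S.OmegaPlus_smooth ht hP,
      d_eq_zero_of_isParallel S.OmegaMinus_smooth ht hQ⟩
  · rintro ⟨hw, hP, hQ⟩
    obtain ⟨cov, ht, hg, hK, hw', hP', hQ'⟩ := S.adaptedFields.exists_connection hw
      ((d_ofReal_eq_zero_iff S.OmegaPlus_smooth).2 hP)
      ((d_ofReal_eq_zero_iff S.OmegaMinus_smooth).2 hQ)
    refine ⟨cov, ht, hg, hK, hw', ?_, ?_⟩
    · rw [← mapCoeff_reCLM_ofRealCLM S.OmegaPlus]
      exact isParallel_mapCoeff _ (S.OmegaPlus_smooth.mapCoeff _) hP'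
    · rw [← mapCoeff_reCLM_ofRealCLM S.OmegaMinus]
      exact isParallel_mapCoeff _ (S.OmegaMinus_smooth.mapCoeff _) hQ'

/-- Closedness of a combination `a Ω₊ + ā Ω₋ + r ω_r ∧ ω_r` with `a` not real and `r` real. -/
theorem d_eq_zero_iff {a : ℂ} {r : ℝ} (ha : a ≠ starRingEnd ℂ a) (hr : r ≠ 0) {Φ : Form M 4 ℂ}
    (hΦ : ∀ x, Φ x = a • complexify (S.OmegaPlus x) + starRingEnd ℂ a • complexify (S.OmegaMinus x)
      + (r : ℂ) • complexify (wedge₂₂ (S.omegaR x) (S.omegaR x))) :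
    Φ.d = 0 ↔ S.omegaR.d = 0 ∧ S.OmegaPlus.d = 0 ∧ S.OmegaMinus.d = 0 := by
  rw [S.adaptedFields.d_eq_zero_iff ha (Complex.ofReal_ne_zero.2 hr) hΦ (fun x v => ?_)
    (Complex.conj_ofReal r), d_ofReal_eq_zero_iff S.OmegaPlus_smooth,
    d_ofReal_eq_zero_iff S.OmegaMinus_smooth]
  rw [extDeriv_inChart_mapCoeff _ S.OmegaPlus_smooth, extDeriv_inChart_mapCoeff _ S.OmegaMinus_smooth]
  simp

theorem d_lorentzianCayleyForm_eq_zero_iff : S.lorentzianCayleyForm.d = 0 ↔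
    S.omegaR.d = 0 ∧ S.OmegaPlus.d = 0 ∧ S.OmegaMinus.d = 0 := by
  have hc : starRingEnd ℂ (Complex.I / 2) = -(Complex.I / 2) := by
    rw [map_div₀, Complex.conj_I, map_ofNat, neg_div]
  refine S.d_eq_zero_iff (a := Complex.I / 2) (r := 1 / 2) ?_ (by norm_num) fun x => ?_
  · rw [hc]
    exact self_ne_neg.2 (by simp)
  · rw [hc, lorentzianCayleyForm]
    push_cast
    module

theorem d_complexCayleyForm_eq_zero_iff {θ : ℝ} (h₀ : 0 < θ) (h₁ : θ < Real.pi / 2) :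
    (S.complexCayleyForm θ).d = 0 ↔
      S.omegaR.d = 0 ∧ S.OmegaPlus.d = 0 ∧ S.OmegaMinus.d = 0 := by
  -- The coefficient of Ω₊ is ½ e^{2iθ}, and sin 2θ ≠ 0 says exactly that it is not real, that is,
  -- different from the coefficient of Ω₋.
  have hs : 0 < Real.sin (2 * θ) := Real.sin_pos_of_pos_of_lt_pi (by linarith) (by linarith)
  have hc : starRingEnd ℂ (((Real.cos (2 * θ) / 2 : ℝ) : ℂ)
      + Complex.I * ((Real.sin (2 * θ) / 2 : ℝ) : ℂ))
      = ((Real.cos (2 * θ) / 2 : ℝ) : ℂ) - Complex.I * ((Real.sin (2 * θ) / 2 : ℝ) : ℂ) := by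
    rw [map_add, map_mul, Complex.conj_ofReal, Complex.conj_ofReal, Complex.conj_I]
    ring
  refine S.d_eq_zero_iff (a := ((Real.cos (2 * θ) / 2 : ℝ) : ℂ)
      + Complex.I * ((Real.sin (2 * θ) / 2 : ℝ) : ℂ)) (r := 1 / 2) ?_ (by norm_num) fun x => ?_
  · rw [hc]
    intro h
    have := congrArg Complex.im h
    simp only [Complex.add_im, Complex.sub_im, Complex.ofReal_im, Complex.I_mul_im,
      Complex.ofReal_re] at this
    linarith
  · rw [hc, complexCayleyForm]
    push_cast
    module

end SL4Structure

namespace SU22Structure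

variable (S : SU22Structure M)

theorem adaptedFields : AdaptedFields Complex.I (-1) 1 S.g S.J S.omega S.Omega
    (S.Omega.mapCoeff (Complex.conjCLE : ℂ →L[ℝ] ℂ)) where
  sq_lam := by simp
  ne_zero := by norm_num
  g_smooth := S.g_smooth
  L_smooth := S.J_smooth
  w_smooth := S.omega_smooth
  P_smooth := S.Omega_smooth
  Q_smooth := S.Omega_smooth.mapCoeff _
  adapted x := by
    obtain ⟨e, hg, hJ, hw, hP⟩ := S.exists_adapted_basis x
    have h := isAdapted_modelOmegaC (e := e) (J := (S.J x).toLinearMap) hJ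
    rw [← (funext₂ hg : (fun u v => S.g x u v) = modelMetric e),
      ← (funext hw : ⇑(S.omega x) = modelOmega e),
      ← (funext hP : ⇑(S.Omega x) = modelOmegaC e)] at h
    exact h

theorem isIntegrable_iff : S.IsIntegrable ↔ S.omega.d = 0 ∧ S.Omega.d = 0 := by
  constructor
  · rintro ⟨cov, ht, -, -, hw, hP⟩
    exact ⟨d_eq_zero_of_isParallel S.omega_smooth ht hw,
      d_eq_zero_of_isParallel S.Omega_smooth ht hP⟩
  · rintro ⟨hw, hP⟩
    obtain ⟨cov, ht, hg, hJ, hw', hP', -⟩ := S.adaptedFields.exists_connection hw hP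
      (d_mapCoeff_eq_zero _ S.Omega_smooth hP)
    exact ⟨cov, ht, hg, hJ, hw', hP'⟩

theorem d_complexCayleyForm_eq_zero_iff {τ : ℝ} (hτ : τ ≠ 0) :
    (S.complexCayleyForm τ).d = 0 ↔ S.omega.d = 0 ∧ S.Omega.d = 0 := by
  have hs : Real.sinh (2 * τ) ≠ 0 := by simpa using hτ
  rw [S.adaptedFields.d_eq_zero_iff
    -- Writing Re Ω and i Im Ω as half the sum and half the difference of Ω and its conjugate gives
    -- coefficients ½ e^{2τ} and ½ e^{−2τ}. They are real and differ exactly when sinh 2τ ≠ 0;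
    -- conjugation now exchanges the two forms instead of the coefficients.
    (a := (((Real.cosh (2 * τ) + Real.sinh (2 * τ)) / 2 : ℝ) : ℂ))
    (b := (((Real.cosh (2 * τ) - Real.sinh (2 * τ)) / 2 : ℝ) : ℂ)) (r := ((-1 / 2 : ℝ) : ℂ))
    ?_ (by norm_num) (fun x => ?_) (fun x v => ?_) (Complex.conj_ofReal _)]
  · exact ⟨fun h => ⟨h.1, h.2.1⟩, fun h => ⟨h.1, h.2, d_mapCoeff_eq_zero _ S.Omega_smooth h.2⟩⟩
  · intro h
    have := Complex.ofReal_injective h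
    exact hs (by linarith)
  · ext v
    have e1 : complexify (rePart (S.Omega x)) v = ((S.Omega x v).re : ℂ) := rfl
    have e2 : complexify (imPart (S.Omega x)) v = ((S.Omega x v).im : ℂ) := rfl
    have e3 : S.Omega.mapCoeff (Complex.conjCLE : ℂ →L[ℝ] ℂ) x v = starRingEnd ℂ (S.Omega x v) :=
      rfl
    simp only [complexCayleyForm, ContinuousAlternatingMap.add_apply,
      ContinuousAlternatingMap.sub_apply, ContinuousAlternatingMap.smul_apply, e1, e2, e3,
      smul_eq_mul]
    have e4 : complexify (wedge₂₂ (S.omega x) (S.omega x)) v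
      = ((wedge₂₂ (S.omega x) (S.omega x) v : ℝ) : ℂ) := rfl
    rw [e4]
    generalize Real.cosh (2 * τ) = p, Real.sinh (2 * τ) = q
    apply Complex.ext
    · simp
      ring
    · simp
      ring
  · rw [extDeriv_inChart_mapCoeff _ S.Omega_smooth]
    simp only [map_add, map_mul, Complex.conj_ofReal, ContinuousLinearEquiv.coe_coe,
      Complex.conjCLE_apply, Complex.conj_conj]
    ring

end SU22Structure

end Structures

end

end SplitCayley
theorem mainTheorem2 {M : Type*} [TopologicalSpace M]
    [ChartedSpace (EuclideanSpace ℝ (Fin 8)) M] [IsManifold (𝓡 8) ∞ M] :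
    (∀ S : SplitCayley.SL4Structure M,
      (S.IsIntegrable ↔ S.lorentzianCayleyForm.d = 0) ∧
      (S.lorentzianCayleyForm.d = 0 ↔ S.omegaR.d = 0 ∧ S.OmegaPlus.d = 0 ∧ S.OmegaMinus.d = 0)) ∧
    (∀ (S : SplitCayley.SL4Structure M) (θ : ℝ), 0 < θ → θ < Real.pi / 2 →
      (S.IsIntegrable ↔ (S.complexCayleyForm θ).d = 0)) ∧
    (∀ (S : SplitCayley.SU22Structure M) (τ : ℝ), τ ≠ 0 →
      (S.IsIntegrable ↔ (S.complexCayleyForm τ).d = 0)) := by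
  refine ⟨fun S => ⟨?_, S.d_lorentzianCayleyForm_eq_zero_iff⟩, fun S θ h₀ h₁ => ?_,
    fun S τ hτ => ?_⟩
  · rw [S.isIntegrable_iff, S.d_lorentzianCayleyForm_eq_zero_iff]
  · rw [S.isIntegrable_iff, S.d_complexCayleyForm_eq_zero_iff h₀ h₁]
  · rw [S.isIntegrable_iff, S.d_complexCayleyForm_eq_zero_iff hτ]
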